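/- A \emph{$2\times4$ block} is a subset of $\mathbb{R}^3$ of the form $[x,x+2]\times[y,y+4]\times[z,z+1]$ or $[x,x+4]\times[y,y+2]\times[z,z+1]$ with $x,y,z\in\mathbb{Z}$. One block \emph{sits on} another if it occupies the layer immediately above that of the other block and the horizontal projections of the two blocks have intersecting interiors (so at least one stud of the lower block is inserted into the upper one). A \emph{contiguous building} is a nonempty finite set of blocks with pairwise disjoint interiors that is connected with respect to the relation that one of two blocks sits on the other. Let $T_{2\times4}(n)$ be the number of contiguous buildings with exactly $n$ blocks, counted up to translations and rotations in the $xy$-plane. Theorem. The limit $s_{2\times4}=\lim_{n\to\infty}\frac{\log T_{2\times4}(n)}{n}$ exists in $\mathbb{R}$, and $h_{2\times4}:=\exp(s_{2\times4})$ satisfies $$h_{2\times4}>78.32.$$ -/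

import Mathlib

open Filter Topology

namespace Lego

/-- A position of a `2 × 4` block: the block is the box
`[x, x + lenX] × [y, y + lenY] × [z, z + 1]`, where the side lengths `(lenX, lenY)` are `(2, 4)`
if `rot = false` and `(4, 2)` if `rot = true`. -/
@[ext]
structure Block where
  x : ℤ
  y : ℤ
  z : ℤ
  rot : Bool
deriving DecidableEq

namespace Block

/-- Side length in the first horizontal direction. -/
def lenX (c : Block) : ℤ := if c.rot then 4 else 2

/-- Side length in the second horizontal direction. -/
def lenY (c : Block) : ℤ := if c.rot then 2 else 4

/-- The interiors of the horizontal projections `[x, x + lenX] × [y, y + lenY]` of the two blocks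
intersect. -/
def Overlap (c d : Block) : Prop :=
  c.x < d.x + d.lenX ∧ d.x < c.x + c.lenX ∧ c.y < d.y + d.lenY ∧ d.y < c.y + c.lenY

/-- Two blocks collide if the interiors of the two boxes intersect. -/
def Collide (c d : Block) : Prop := c.z = d.z ∧ c.Overlap d

/-- `c` sits directly on top of `d`, at least one stud of `d` being inserted into `c`. -/
def SitsOn (c d : Block) : Prop := c.z = d.z + 1 ∧ c.Overlap d

/-- Rotation of the block by 90 degrees around the vertical axis through the origin,
`(u, v, w) ↦ (-v, u, w)`. -/
def turn (c : Block) : Block := ⟨-c.y - c.lenY, c.x, c.z, !c.rot⟩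

/-- Translation of the block by `(p, q, r)`. -/
def shift (p q r : ℤ) (c : Block) : Block := ⟨c.x + p, c.y + q, c.z + r, c.rot⟩

theorem turn_shift (p q r : ℤ) (c : Block) :
    turn (shift p q r c) = shift (-q) p r (turn c) := by
  rcases c with ⟨x, y, z, _ | _⟩ <;> simp [turn, shift, lenY] <;> ring

theorem turn_four (c : Block) : turn^[4] c = c := by
  rcases c with ⟨x, y, z, _ | _⟩ <;> simp [turn, lenY]

theorem turn_iterate_shift (k : ℕ) (p q r : ℤ) :
    ∃ p' q' : ℤ, ∀ c : Block, turn^[k] (shift p q r c) = shift p' q' r (turn^[k] c) := by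
  induction k with
  | zero => exact ⟨p, q, fun _ => rfl⟩
  | succ k ih =>
    obtain ⟨p', q', h⟩ := ih
    refine ⟨-q', p', fun c => ?_⟩
    rw [Function.iterate_succ_apply', Function.iterate_succ_apply', h, turn_shift]

theorem turn_four_mul (k : ℕ) (c : Block) : turn^[4 * k] c = c := by
  have h : turn^[4] = id := funext turn_four
  rw [Function.iterate_mul, h, Function.iterate_id, id]

end Block

/-- The graph on all block positions in which two blocks are joined if one sits on the other. -/
def attachGraph : SimpleGraph Block where
  Adj c d := c.SitsOn d ∨ d.SitsOn c
  symm := ⟨fun _ _ h => h.symm⟩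
  loopless := ⟨fun c h => by
    rcases h with h | h <;> exact absurd h.1 (by omega)⟩

/-- A contiguous building: a nonempty finite set of blocks, no two of which collide, and which is
connected through blocks sitting on each other. -/
def IsBuilding (s : Finset Block) : Prop :=
  (∀ c ∈ s, ∀ d ∈ s, c ≠ d → ¬ c.Collide d) ∧ (attachGraph.induce (s : Set Block)).Connected

/-- The contiguous buildings with exactly `n` blocks. -/
def Building (n : ℕ) : Type := {s : Finset Block // s.card = n ∧ IsBuilding s}

/-- `t` arises from `s` by a rotation in the horizontal plane followed by a translation. -/
def Congruent (s t : Finset Block) : Prop :=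
  ∃ (k : ℕ) (p q r : ℤ), t = s.image fun c => Block.shift p q r (Block.turn^[k] c)

theorem Congruent.refl (s : Finset Block) : Congruent s s := by
  refine ⟨0, 0, 0, 0, ?_⟩
  simp [Block.shift]

theorem Congruent.symm {s t : Finset Block} (h : Congruent s t) : Congruent t s := by
  obtain ⟨k, p, q, r, rfl⟩ := h
  obtain ⟨p', q', h⟩ := Block.turn_iterate_shift (3 * k) p q r
  refine ⟨3 * k, -p', -q', -r, ?_⟩
  rw [Finset.image_image]
  have key : ((fun c => Block.shift (-p') (-q') (-r) (Block.turn^[3 * k] c)) ∘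
      fun c => Block.shift p q r (Block.turn^[k] c)) = id := by
    funext c
    have h4 : 3 * k + k = 4 * k := by ring
    simp only [Function.comp, h, ← Function.iterate_add_apply, h4, Block.turn_four_mul]
    simp [Block.shift]
  rw [key, Finset.image_id]

theorem Congruent.trans {s t u : Finset Block} (h₁ : Congruent s t) (h₂ : Congruent t u) :
    Congruent s u := by
  obtain ⟨k, p, q, r, rfl⟩ := h₁
  obtain ⟨l, p₂, q₂, r₂, rfl⟩ := h₂
  obtain ⟨p', q', h⟩ := Block.turn_iterate_shift l p q r
  refine ⟨l + k, p' + p₂, q' + q₂, r + r₂, ?_⟩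
  rw [Finset.image_image]
  congr 1
  funext c
  simp only [Function.comp, h, ← Function.iterate_add_apply]
  simp [Block.shift, add_assoc]

/-- Buildings are identified up to translation and rotation. -/
instance buildingSetoid (n : ℕ) : Setoid (Building n) where
  r s t := Congruent s.1 t.1
  iseqv := ⟨fun s => Congruent.refl s.1, Congruent.symm, Congruent.trans⟩

/-- `T n` is the number of contiguous buildings of `n` blocks, up to translation and rotation. -/
noncomputable def T (n : ℕ) : ℕ := Nat.card (Quotient (buildingSetoid n))

/-- The entropy `s = lim log (T n) / n` of a `2 × 4` block. -/
noncomputable def entropy : ℝ := limUnder atTop fun n : ℕ => Real.log (T n) / n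

/-- The exponential growth rate `h = exp s`. -/
noncomputable def growthRate : ℝ := Real.exp entropy

end Lego

namespace Lego

/-! ### Reading off digits -/

/-! Existence of the limit. Let `fixedCount n` count buildings up to translation only; it lies
between `T n` and `4 * T n`, so both have the same growth rate. Putting one building on a top block
of another is injective, which makes `fixedCount` supermultiplicative, and tracing a building by a
closed walk bounds it exponentially. Fekete's lemma gives the limit and also `fixedCount n ≤
exp(limit) ^ n` for every `n`.

Lower bound. Only buildings growing upwards with one or two chosen blocks per new layer are needed.
A partial building is either connected (joined), or each of its blocks is linked to one of its two
top blocks (split), so that the components can still be merged higher up. Only the state and the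
relative position of the top blocks matter for the continuation. The two tables assign an integer
potential to each relative position, and a single top block has potential 1000. With weight `rate =
100 / 7833` per block, each potential is at most the weighted sum of the potentials of all
admissible next layers: the potentials form a subsolution for the transfer operator. This is a
finite check; how the tables were found plays no role.

Iterating the inequality (`potential_le_extensionSum`) shows that the weighted number of buildings
extending a single block by at least `k` blocks is bounded below by a positive constant independent
of `k`. These sums are dominated by tails of `∑ fixedCount (n + 1) * rate ^ n`. If the growth rate
were below `1 / rate = 78.33`, the tails would be dominated by those of a convergent geometric
series and tend to `0`, a contradiction.

To make the finite check feasible in the kernel, each double sum of potentials over two sets of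
cells is read off as one digit of a product of three large integers, a two-dimensional correlation
by Kronecker substitution (`Table.corr_eq`). Symmetries of the plane reduce the check to 64 offsets
for each pair of orientations (`exists_sym_normal`). -/

theorem digit_of_sum {ι : Type*} (s : Finset ι) (t e : ι → ℕ) (w E : ℕ)
    (h : ∑ i ∈ s, t i < 2 ^ w) :
    (∑ i ∈ s, t i * 2 ^ (w * e i)) / 2 ^ (w * E) % 2 ^ w = ∑ i ∈ s with e i = E, t i := by
  classical
  have hB : 0 < 2 ^ (w * E) := by positivity
  -- The lower digits do not carry into position `E`: their total is at most `∑ t` times `2 ^ (w *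
  -- (E - 1))`, and `∑ t < 2 ^ w`.
  have h1 : ∑ i ∈ s with e i < E, t i * 2 ^ (w * e i) < 2 ^ (w * E) := by
    have h2 : (∑ i ∈ s with e i < E, t i * 2 ^ (w * e i)) * 2 ^ w ≤
        (∑ i ∈ s, t i) * 2 ^ (w * E) := by
      rw [Finset.sum_mul, Finset.sum_mul]
      calc _ ≤ ∑ i ∈ s with e i < E, t i * 2 ^ (w * E) := by
            refine Finset.sum_le_sum fun i hi => ?_
            have hi' : e i + 1 ≤ E := (Finset.mem_filter.1 hi).2
            rw [mul_assoc, ← pow_add]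
            refine Nat.mul_le_mul_left _ (Nat.pow_le_pow_right (by norm_num) ?_)
            calc w * e i + w = w * (e i + 1) := by ring
              _ ≤ w * E := Nat.mul_le_mul_left _ hi'
        _ ≤ _ := Finset.sum_le_sum_of_subset (Finset.filter_subset _ _)
    have h3 : (∑ i ∈ s, t i) * 2 ^ (w * E) < 2 ^ w * 2 ^ (w * E) :=
      Nat.mul_lt_mul_of_pos_right h hB
    have h4 := h2.trans_lt h3
    rw [mul_comm (2 ^ w)] at h4
    exact Nat.lt_of_mul_lt_mul_right h4
  have h2 : 2 ^ (w * E) * 2 ^ w ∣ ∑ i ∈ s with E < e i, t i * 2 ^ (w * e i) := by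
    refine Finset.dvd_sum fun i hi => ?_
    have hi' : E + 1 ≤ e i := (Finset.mem_filter.1 hi).2
    rw [← pow_add]
    refine Dvd.dvd.mul_left (pow_dvd_pow _ ?_) _
    calc w * E + w = w * (E + 1) := by ring
      _ ≤ w * e i := Nat.mul_le_mul_left _ hi'
  obtain ⟨q, hq⟩ := h2
  have h3 : ∑ i ∈ s with e i = E, t i * 2 ^ (w * e i) =
      (∑ i ∈ s with e i = E, t i) * 2 ^ (w * E) := by
    rw [Finset.sum_mul]
    refine Finset.sum_congr rfl fun i hi => ?_
    rw [(Finset.mem_filter.1 hi).2]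
  have h4 : ∑ i ∈ s, t i * 2 ^ (w * e i) = (∑ i ∈ s with e i < E, t i * 2 ^ (w * e i)) +
      2 ^ (w * E) * ((∑ i ∈ s with e i = E, t i) + 2 ^ w * q) := by
    rw [mul_add, ← mul_assoc, ← hq, mul_comm (2 ^ (w * E)), ← h3, Finset.sum_filter,
      Finset.sum_filter, Finset.sum_filter, ← Finset.sum_add_distrib, ← Finset.sum_add_distrib]
    refine Finset.sum_congr rfl fun i _ => ?_
    rcases lt_trichotomy (e i) E with h | h | h
    · simp [h, h.ne, h.not_gt]
    · simp [h]
    · simp [h, h.ne', h.not_gt]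
  rw [h4, Nat.add_mul_div_left _ _ hB, Nat.div_eq_of_lt h1, zero_add, Nat.add_mul_mod_self_left]
  exact Nat.mod_eq_of_lt ((Finset.sum_le_sum_of_subset (Finset.filter_subset _ _)).trans_lt h)

/-! ### Cells and potentials -/

/-- The centre of the horizontal projection of a block, with its orientation. -/
abbrev Cell : Type := ℤ × ℤ × Bool

/-- Half of the first side length of a block. -/
def half (r : Bool) : ℕ := bif r then 2 else 1

/-- The projections of the two blocks have intersecting interiors. -/
def Touch (a b : Cell) : Prop :=
  (a.1 - b.1).natAbs < half a.2.2 + half b.2.2 ∧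
    (a.2.1 - b.2.1).natAbs < half (!a.2.2) + half (!b.2.2)

instance (a b : Cell) : Decidable (Touch a b) := by unfold Touch; infer_instance

/-- A table of values for pairs of blocks, indexed by the absolute offset of their centres, for
pairs of equal and of different orientation. -/
structure Table where
  same : List ℕ
  mixed : List ℕ

/-- Entry of an `8 × 8` table, `0` outside. -/
def entry (L : List ℕ) (X Y : ℕ) : ℕ :=
  bif X.blt 8 && Y.blt 8 then L.getD (8 * X + Y) 0 else 0

/-- Value of a table at two blocks of given orientations and absolute offset. -/
def Table.off (T : Table) (r r' : Bool) (X Y : ℕ) : ℕ :=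
  bif r then bif r' then entry T.same Y X else entry T.mixed X Y
  else bif r' then entry T.mixed X Y else entry T.same X Y

/-- Value of a table at two cells. -/
def Table.pot (T : Table) (a b : Cell) : ℕ :=
  T.off a.2.2 b.2.2 (a.1 - b.1).natAbs (a.2.1 - b.2.1).natAbs

/-- Potential of two blocks in the top layer of a connected partial building. -/
def joinedTable : Table where
  same := [0, 0, 0, 0, 2060, 2335, 2406, 2445,
      0, 0, 0, 0, 2211, 2418, 2454, 2452,
      1756, 1903, 2067, 2233, 2386, 2522, 2516, 2469,
      2220, 2303, 2403, 2501, 2582, 2639, 2584, 2488,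
      2477, 2525, 2584, 2638, 2669, 2673, 2603, 2495,
      2693, 2701, 2716, 2724, 2707, 2661, 2583, 2474,
      2650, 2654, 2660, 2657, 2633, 2584, 2511, 2413,
      2516, 2518, 2520, 2513, 2490, 2450, 2391, 2315]
  mixed := [0, 0, 0, 2076, 2391, 2505, 2570, 2476,
      0, 0, 0, 2086, 2401, 2513, 2576, 2480,
      0, 0, 0, 2258, 2504, 2574, 2593, 2489,
      2076, 2086, 2258, 2442, 2614, 2638, 2610, 2496,
      2391, 2401, 2504, 2614, 2706, 2682, 2605, 2487,
      2505, 2513, 2574, 2638, 2682, 2646, 2566, 2451,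
      2570, 2576, 2593, 2610, 2605, 2566, 2491, 2389,
      2476, 2480, 2489, 2496, 2487, 2451, 2389, 2306]

/-- Potential of two blocks in the top layer of a partial building with two components. -/
def splitTable : Table where
  same := [0, 0, 0, 0, 478, 232, 134, 18,
      0, 0, 0, 0, 357, 165, 97, 17,
      645, 550, 457, 355, 239, 102, 61, 15,
      349, 288, 232, 173, 107, 28, 19, 12,
      211, 175, 141, 105, 66, 21, 14, 8,
      35, 34, 30, 25, 19, 13, 8, 4,
      23, 22, 19, 15, 11, 7, 4, 2,
      11, 11, 9, 7, 5, 3, 2, 1]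
  mixed := [0, 0, 0, 460, 229, 137, 25, 16,
      0, 0, 0, 470, 233, 138, 24, 15,
      0, 0, 0, 358, 170, 101, 21, 13,
      460, 470, 358, 241, 105, 64, 17, 10,
      229, 233, 170, 105, 28, 20, 12, 7,
      137, 138, 101, 64, 20, 14, 8, 4,
      25, 24, 21, 17, 12, 8, 4, 2,
      16, 15, 13, 10, 7, 4, 2, 1]

/-! ### Sums over pairs of cells as products of large integers -/

/-- `f 0 + ⋯ + f (n - 1)`, by structural recursion. -/
def sumTo (n : ℕ) (f : ℕ → ℕ) : ℕ := Nat.rec 0 (fun i s => s + f i) n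

theorem sumTo_eq (n : ℕ) (f : ℕ → ℕ) : sumTo n f = ∑ i ∈ Finset.range n, f i := by
  induction n with
  | zero => rfl
  | succ n ih => rw [Finset.sum_range_succ, ← ih]; rfl

/-- Distance of two natural numbers. -/
def gap (i j : ℕ) : ℕ := (i - j) + (j - i)

/-- The set of positions `p` as a number in base `2 ^ w`. -/
def encode (w : ℕ) (p : ℕ → ℕ → Bool) : ℕ :=
  sumTo 14 fun i => sumTo 14 fun j => bif p i j then 2 ^ (w * (32 * i + j)) else 0

/-- The reflected set of positions `p` as a number in base `2 ^ w`. -/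
def encodeRev (w : ℕ) (p : ℕ → ℕ → Bool) : ℕ :=
  sumTo 14 fun i => sumTo 14 fun j =>
    bif p i j then 2 ^ (w * (32 * (13 - i) + (13 - j))) else 0

/-- The values of a table as digits in base `2 ^ w`. -/
def Table.encode (w : ℕ) (T : Table) (r r' : Bool) : ℕ :=
  sumTo 15 fun p => sumTo 15 fun q => T.off r r' (gap p 7) (gap q 7) * 2 ^ (w * (32 * p + q))

/-- The sum of the table values over all pairs from two sets of positions. -/
def Table.corr (w : ℕ) (T : Table) (r r' : Bool) (f g : ℕ → ℕ → Bool) : ℕ :=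
  -- The exponent 660 is `32 * 20 + 20` with `20 = 13 + 7`: the reflection contributes 13 and the
  -- centre of the table 7 in each coordinate.
  Lego.encode w f * encodeRev w g * T.encode w r r' / 2 ^ (w * 660) % 2 ^ w

/-- The same for sets of positions with orientations. -/
def Table.pairSum (w : ℕ) (T : Table) (f g : Bool → ℕ → ℕ → Bool) : ℕ :=
  T.corr w false false (f false) (g false) + T.corr w false true (f false) (g true) +
    (T.corr w true false (f true) (g false) + T.corr w true true (f true) (g true))

/-- The cell at a position. -/
def cellAt (p : Bool × ℕ × ℕ) : Cell := (p.2.1, p.2.2, p.1)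

theorem cellAt_injective : Function.Injective cellAt := by
  rintro ⟨r, i, j⟩ ⟨r', i', j'⟩ h
  simp only [cellAt, Prod.mk.injEq, Nat.cast_inj] at h
  obtain ⟨rfl, rfl, rfl⟩ := h
  rfl

/-- The cells described by a set of positions. -/
def cells (f : Bool → ℕ → ℕ → Bool) : Finset Cell :=
  ((Finset.univ ×ˢ Finset.range 14 ×ˢ Finset.range 14 : Finset (Bool × ℕ × ℕ)).filter
    fun p => f p.1 p.2.1 p.2.2).map ⟨cellAt, cellAt_injective⟩

theorem sum_cells {M : Type*} [AddCommMonoid M] (f : Bool → ℕ → ℕ → Bool) (F : Cell → M) :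
    ∑ c ∈ cells f, F c = ∑ r : Bool, ∑ p ∈ Finset.range 14 ×ˢ Finset.range 14,
      if f r p.1 p.2 then F (p.1, p.2, r) else 0 := by
  rw [cells, Finset.sum_map, Finset.sum_filter, Finset.sum_product]
  rfl

theorem natAbs_sub_cast (i j : ℕ) : ((i : ℤ) - j).natAbs = gap i j := by
  unfold gap; omega

/-- The entries of the table are less than `2 ^ 12`. -/
def Table.Small (T : Table) : Prop := (∀ n ∈ T.same, n < 4096) ∧ ∀ n ∈ T.mixed, n < 4096

theorem entry_lt {L : List ℕ} (h : ∀ n ∈ L, n < 4096) (X Y : ℕ) : entry L X Y < 4096 := by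
  unfold entry
  rcases (X.blt 8 && Y.blt 8) with _ | _
  · simp
  · simp only [cond_true]
    by_cases hl : 8 * X + Y < L.length
    · rw [List.getD_eq_getElem _ _ hl]; exact h _ (List.getElem_mem hl)
    · rw [List.getD_eq_default _ _ (by omega)]; norm_num

theorem Table.Small.off_lt {T : Table} (h : T.Small) (r r' : Bool) (X Y : ℕ) :
    T.off r r' X Y < 4096 := by
  cases r <;> cases r' <;> simp only [Table.off, cond_true, cond_false] <;>
    first | exact entry_lt h.1 _ _ | exact entry_lt h.2 _ _

theorem Table.off_eq_zero (T : Table) (r r' : Bool) {X Y : ℕ} (h : 8 ≤ X ∨ 8 ≤ Y) :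
    T.off r r' X Y = 0 := by
  have h1 : (X.blt 8 && Y.blt 8) = false := by
    rw [Bool.and_eq_false_iff]
    exact h.imp (fun h => by rw [← Bool.not_eq_true, Nat.blt_eq]; omega)
      (fun h => by rw [← Bool.not_eq_true, Nat.blt_eq]; omega)
  have h2 : (Y.blt 8 && X.blt 8) = false := by rw [Bool.and_comm]; exact h1
  cases r <;> cases r' <;> simp [Table.off, entry, h1, h2]

/-- Expanding the product gives one term for each triple (cell `c`, reflected cell `d`, table
position `p`). Digit 660 selects `c + (13 - d) + p = 20` in both coordinates, that is `p - 7 = d -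
c`. Coordinate sums are at most 40, so a sum congruent to 20 modulo 32 equals 20 and base 32
separates the coordinates sufficiently. -/
theorem Table.corr_eq {w : ℕ} (hw : 64 ≤ w) {T : Table} (hT : T.Small) (r r' : Bool)
    (f g : ℕ → ℕ → Bool) :
    T.corr w r r' f g = ∑ c ∈ Finset.range 14 ×ˢ Finset.range 14,
      ∑ d ∈ Finset.range 14 ×ˢ Finset.range 14,
        if f c.1 c.2 ∧ g d.1 d.2 then T.off r r' (gap c.1 d.1) (gap c.2 d.2) else 0 := by
  set R := Finset.range 14 ×ˢ Finset.range 14 with hR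
  set Q := Finset.range 15 ×ˢ Finset.range 15 with hQ
  clear_value R Q
  set t : (ℕ × ℕ) × (ℕ × ℕ) × (ℕ × ℕ) → ℕ := fun i =>
    if f i.1.1 i.1.2 ∧ g i.2.1.1 i.2.1.2 then T.off r r' (gap i.2.2.1 7) (gap i.2.2.2 7) else 0
    with ht
  set e : (ℕ × ℕ) × (ℕ × ℕ) × (ℕ × ℕ) → ℕ := fun i =>
    (32 * i.1.1 + i.1.2) + (32 * (13 - i.2.1.1) + (13 - i.2.1.2)) + (32 * i.2.2.1 + i.2.2.2)
    with he
  have h1 : Lego.encode w f = ∑ c ∈ R, if f c.1 c.2 then 2 ^ (w * (32 * c.1 + c.2)) else 0 := by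
    simp only [Lego.encode, sumTo_eq, hR, Finset.sum_product, Bool.cond_eq_ite]
  have h2 : encodeRev w g = ∑ d ∈ R,
      if g d.1 d.2 then 2 ^ (w * (32 * (13 - d.1) + (13 - d.2))) else 0 := by
    simp only [encodeRev, sumTo_eq, hR, Finset.sum_product, Bool.cond_eq_ite]
  have h3 : T.encode w r r' = ∑ p ∈ Q,
      T.off r r' (gap p.1 7) (gap p.2 7) * 2 ^ (w * (32 * p.1 + p.2)) := by
    simp only [Table.encode, sumTo_eq, hQ, Finset.sum_product]
  have h4 : Lego.encode w f * encodeRev w g * T.encode w r r' =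
      ∑ i ∈ R ×ˢ R ×ˢ Q, t i * 2 ^ (w * e i) := by
    rw [h1, h2, h3, mul_assoc, Finset.sum_mul_sum, Finset.sum_mul_sum, Finset.sum_product]
    refine Finset.sum_congr rfl fun c _ => ?_
    rw [Finset.sum_product]
    refine Finset.sum_congr rfl fun d _ => ?_
    rw [Finset.mul_sum]
    refine Finset.sum_congr rfl fun p _ => ?_
    simp only [ht, he]
    by_cases hf : f c.1 c.2
    · by_cases hg : g d.1 d.2
      · simp only [hf, hg, and_self, if_true, mul_add, pow_add]
        ac_rfl
      · simp only [hf, hg, and_false, if_false, mul_zero, zero_mul, Bool.false_eq_true]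
    · simp only [hf, false_and, if_false, zero_mul, Bool.false_eq_true]
  -- No carries occur: there are `196 * 196 * 225` triples, each contributing at most 4096.
  have h5 : ∑ i ∈ R ×ˢ R ×ˢ Q, t i < 2 ^ w := by
    have hle : ∀ i, t i ≤ 4096 := by
      intro i
      rw [ht]
      dsimp only
      split_ifs
      · exact (hT.off_lt _ _ _ _).le
      · exact Nat.zero_le _
    have hc : (R ×ˢ R ×ˢ Q).card = 8643600 := by
      rw [Finset.card_product, Finset.card_product, hR, hQ, Finset.card_product,
        Finset.card_product, Finset.card_range, Finset.card_range]
    calc ∑ i ∈ R ×ˢ R ×ˢ Q, t i ≤ ∑ i ∈ R ×ˢ R ×ˢ Q, 4096 :=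
          Finset.sum_le_sum fun i _ => hle i
      _ = 8643600 * 4096 := by rw [Finset.sum_const, hc, smul_eq_mul]
      _ < 2 ^ 64 := by norm_num
      _ ≤ 2 ^ w := Nat.pow_le_pow_right (by norm_num) hw
  rw [Table.corr, h4, digit_of_sum _ _ _ _ _ h5, Finset.sum_filter, Finset.sum_product]
  refine Finset.sum_congr rfl fun c hc => ?_
  rw [Finset.sum_product]
  refine Finset.sum_congr rfl fun d hd => ?_
  simp only [hR, Finset.mem_product, Finset.mem_range] at hc hd
  by_cases hfg : f c.1 c.2 ∧ g d.1 d.2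
  · simp only [ht, he, hfg, and_self, if_true]
    by_cases hin : gap c.1 d.1 < 8 ∧ gap c.2 d.2 < 8
    · rw [Finset.sum_eq_single (7 + d.1 - c.1, 7 + d.2 - c.2)]
      · unfold gap at hin
        have e1 : gap (7 + d.1 - c.1) 7 = gap c.1 d.1 := by unfold gap; omega
        have e2 : gap (7 + d.2 - c.2) 7 = gap c.2 d.2 := by unfold gap; omega
        rw [if_pos (by omega), e1, e2]
      · intro p hp hne
        rw [if_neg]
        intro h
        apply hne
        simp only [hQ, Finset.mem_product, Finset.mem_range] at hp
        ext <;> simp only <;> omega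
      · intro h
        exfalso
        apply h
        unfold gap at hin
        simp only [hQ, Finset.mem_product, Finset.mem_range]
        omega
    · rw [T.off_eq_zero _ _ (by omega)]
      refine Finset.sum_eq_zero fun p hp => ?_
      rw [if_neg]
      intro h
      apply hin
      simp only [hQ, Finset.mem_product, Finset.mem_range] at hp
      unfold gap
      omega
  · simp [ht, hfg]

theorem Table.pairSum_eq {w : ℕ} (hw : 64 ≤ w) {T : Table} (hT : T.Small)
    (f g : Bool → ℕ → ℕ → Bool) :
    T.pairSum w f g = ∑ c ∈ cells f, ∑ d ∈ cells g, T.pot c d := by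
  have key : ∀ r r' : Bool, T.corr w r r' (f r) (g r') =
      ∑ c ∈ Finset.range 14 ×ˢ Finset.range 14, if f r c.1 c.2 then
        ∑ d ∈ Finset.range 14 ×ˢ Finset.range 14,
          if g r' d.1 d.2 then T.pot (c.1, c.2, r) (d.1, d.2, r') else 0
      else 0 := by
    intro r r'
    rw [Table.corr_eq hw hT]
    refine Finset.sum_congr rfl fun c _ => ?_
    by_cases hf : f r c.1 c.2
    · simp only [hf, true_and, if_true, Table.pot, natAbs_sub_cast]
    · simp [hf]
  simp only [sum_cells, Fintype.sum_bool, Table.pairSum, key]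
  generalize Finset.range 14 ×ˢ Finset.range 14 = R
  rw [add_comm, ← Finset.sum_add_distrib, ← Finset.sum_add_distrib]
  refine congr_arg₂ _ (Finset.sum_congr rfl fun c _ => ?_) (Finset.sum_congr rfl fun c _ => ?_) <;>
  · split_ifs
    · rw [add_comm]
    · rfl

/-! ### The numerical inequalities -/

/-- The positions at which a block touches the block at a given position. -/
def near (p : Bool × ℕ × ℕ) (r : Bool) (i j : ℕ) : Bool :=
  (gap p.2.1 i).blt (half p.1 + half r) && (gap p.2.2 j).blt (half (!p.1) + half (!r))

/-- Number of elements of a set of positions with orientations. -/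
def count (f : Bool → ℕ → ℕ → Bool) : ℕ :=
  sumTo 14 fun i => sumTo 14 fun j => (f true i j).toNat + (f false i j).toNat

/-- Sum of the split potentials of a block and an arbitrary second block. -/
def splitTotal (r : Bool) : ℕ :=
  sumTo 15 fun p => sumTo 15 fun q =>
    splitTable.off r true (gap p 7) (gap q 7) + splitTable.off r false (gap p 7) (gap q 7)

/-- The inequality for two blocks in the top layer of a connected partial building. -/
def joinedCheck (V : ℕ) (p q : Bool × ℕ × ℕ) : Bool :=
  let S := fun r i j => near p r i j || near q r i j
  -- The inequality `V ≤ rate * 1000 * count + rate ^ 2 / 2 * pairs`, multiplied by `2 * 7833 ^ 2`.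
  -- Pairs with exactly one member in `S` contribute twice `count S * 39448` minus the split sum
  -- over `S × S`, where 39448 is the sum over all second blocks. The subtracted part stands on the
  -- left to stay in `ℕ`.
  (2 * 7833 ^ 2 * V + 10000 * (2 * splitTable.pairSum 64 S S)).ble
    (2 * 100 * 7833 * (1000 * count S) +
      10000 * (joinedTable.pairSum 64 S S + 2 * (count S * 39448)))

/-- The inequality for two blocks in the top layer of a partial building with two components. -/
def splitCheck (V : ℕ) (p q : Bool × ℕ × ℕ) : Bool :=
  let S := fun r i j => near p r i j || near q r i j
  let J := fun r i j => near p r i j && near q r i j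
  let A := fun r i j => near p r i j && !near q r i j
  let B := fun r i j => near q r i j && !near p r i j
  let X := fun r i j => near p r i j ^^ near q r i j
  -- Joined pairs are `J × S` together with `X × J`. Split pairs are `A × B`, `B × A`, and those
  -- with one block in `J` and the other outside `S`; the latter are again computed as a total minus
  -- a correction.
  (2 * 7833 ^ 2 * V + 10000 * (2 * splitTable.pairSum 64 J S)).ble
    (2 * 100 * 7833 * (1000 * count J) +
      10000 * (joinedTable.pairSum 64 J S + joinedTable.pairSum 64 X J +
        2 * splitTable.pairSum 64 A B + 2 * (count J * 39448)))

/-- `f i` for all `i < n`, by structural recursion. -/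
def allTo (n : ℕ) (f : ℕ → Bool) : Bool := Nat.rec true (fun i s => s && f i) n

theorem allTo_spec {n : ℕ} {f : ℕ → Bool} (h : allTo n f = true) {i : ℕ} (hi : i < n) :
    f i = true := by
  induction n with
  | zero => omega
  | succ n ih =>
    have h' : (allTo n f && f n) = true := h
    rw [Bool.and_eq_true] at h'
    rcases Nat.lt_succ_iff_lt_or_eq.1 hi with hi | rfl
    · exact ih h'.1 hi
    · exact h'.2

/-! ### Kernel evaluation of the inequalities. -/

theorem splitTotal_eq (r : Bool) : splitTotal r = 39448 := by
  cases r <;> decide +kernel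

/-- The two top blocks coincide here, and 1000 is the potential assigned to a single top block. -/
theorem joinedCheck_single : joinedCheck 1000 (false, 3, 3) (false, 3, 3) = true := by
  decide +kernel

theorem joinedCheck_same : (allTo 8 fun x => allTo 8 fun y =>
    joinedCheck (joinedTable.off false false x y) (false, 3, 3) (false, 3 + x, 3 + y)) = true := by
  decide +kernel

theorem joinedCheck_mixed : (allTo 8 fun x => allTo 8 fun y =>
    joinedCheck (joinedTable.off false true x y) (false, 3, 3) (true, 3 + x, 3 + y)) = true := by
  decide +kernel

theorem splitCheck_same : (allTo 8 fun x => allTo 8 fun y =>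
    splitCheck (splitTable.off false false x y) (false, 3, 3) (false, 3 + x, 3 + y)) = true := by
  decide +kernel

theorem splitCheck_mixed : (allTo 8 fun x => allTo 8 fun y =>
    splitCheck (splitTable.off false true x y) (false, 3, 3) (true, 3 + x, 3 + y)) = true := by
  decide +kernel

theorem joinedTable_small : joinedTable.Small := by
  constructor <;> decide +kernel

theorem splitTable_small : splitTable.Small := by
  constructor <;> decide +kernel

open scoped ENNReal

/-! ### Symmetries of the plane -/

/-- A bijection of the cells that respects contact and the potentials. -/
structure IsSym (e : Cell ≃ Cell) : Prop where
  touch : ∀ a b, Touch (e a) (e b) ↔ Touch a b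
  joined : ∀ a b, joinedTable.pot (e a) (e b) = joinedTable.pot a b
  split : ∀ a b, splitTable.pot (e a) (e b) = splitTable.pot a b

theorem IsSym.trans {e f : Cell ≃ Cell} (he : IsSym e) (hf : IsSym f) : IsSym (e.trans f) where
  touch _ _ := (hf.touch _ _).trans (he.touch _ _)
  joined _ _ := (hf.joined _ _).trans (he.joined _ _)
  split _ _ := (hf.split _ _).trans (he.split _ _)

/-- Translation of cells. -/
def shiftCell (p q : ℤ) : Cell ≃ Cell where
  toFun a := (a.1 + p, a.2.1 + q, a.2.2)
  invFun a := (a.1 - p, a.2.1 - q, a.2.2)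
  left_inv a := by simp
  right_inv a := by simp

/-- Reflection of the first coordinate. -/
def reflectFst : Cell ≃ Cell where
  toFun a := (-a.1, a.2)
  invFun a := (-a.1, a.2)
  left_inv a := by simp
  right_inv a := by simp

/-- Reflection of the second coordinate. -/
def reflectSnd : Cell ≃ Cell where
  toFun a := (a.1, -a.2.1, a.2.2)
  invFun a := (a.1, -a.2.1, a.2.2)
  left_inv a := by simp
  right_inv a := by simp

/-- Exchange of the two coordinates. -/
def transposeCell : Cell ≃ Cell where
  toFun a := (a.2.1, a.1, !a.2.2)
  invFun a := (a.2.1, a.1, !a.2.2)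
  left_inv a := by simp
  right_inv a := by simp

theorem isSym_shift (p q : ℤ) : IsSym (shiftCell p q) := by
  constructor <;> intro a b <;> simp [Touch, Table.pot, shiftCell]

theorem isSym_reflectFst : IsSym reflectFst := by
  have h : ∀ u v : ℤ, (-u + v).natAbs = (u - v).natAbs := by intro u v; omega
  constructor <;> intro a b <;> simp [Touch, Table.pot, reflectFst, h]

theorem isSym_reflectSnd : IsSym reflectSnd := by
  have h : ∀ u v : ℤ, (-u + v).natAbs = (u - v).natAbs := by intro u v; omega
  constructor <;> intro a b <;> simp [Touch, Table.pot, reflectSnd, h]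

/-- The mixed part of the table is symmetric. -/
def Table.Symm (T : Table) : Prop := ∀ X < 8, ∀ Y < 8, entry T.mixed X Y = entry T.mixed Y X

theorem joinedTable_symm : joinedTable.Symm := by unfold Table.Symm; decide +kernel

theorem splitTable_symm : splitTable.Symm := by unfold Table.Symm; decide +kernel

theorem Table.Symm.entry_comm {T : Table} (h : T.Symm) (X Y : ℕ) :
    entry T.mixed X Y = entry T.mixed Y X := by
  by_cases hXY : X < 8 ∧ Y < 8
  · exact h X hXY.1 Y hXY.2
  · have h1 := T.off_eq_zero false true (X := X) (Y := Y) (by omega)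
    have h2 := T.off_eq_zero false true (X := Y) (Y := X) (by omega)
    exact h1.trans h2.symm

/-- Transposition changes both orientations: `Table.off` already swaps the arguments of `same`, but
mixed pairs need the table itself to be symmetric. -/
theorem Table.Symm.pot_transpose {T : Table} (h : T.Symm) (a b : Cell) :
    T.pot (transposeCell a) (transposeCell b) = T.pot a b := by
  obtain ⟨u, v, _ | _⟩ := a <;> obtain ⟨u', v', _ | _⟩ := b <;>
    simp [Table.pot, transposeCell, Table.off, h.entry_comm (v - v').natAbs]

theorem Table.pot_comm (T : Table) (a b : Cell) : T.pot a b = T.pot b a := by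
  obtain ⟨u, v, _ | _⟩ := a <;> obtain ⟨u', v', _ | _⟩ := b <;>
    simp [Table.pot, Table.off, ← Int.natAbs_neg (u - u'), ← Int.natAbs_neg (v - v')]

theorem isSym_transpose : IsSym transposeCell where
  touch a b := by
    obtain ⟨u, v, _ | _⟩ := a <;> obtain ⟨u', v', _ | _⟩ := b <;>
      simp [Touch, transposeCell, and_comm]
  joined := joinedTable_symm.pot_transpose
  split := splitTable_symm.pot_transpose

/-- Translate `a` to the origin, transpose if necessary to fix its orientation, then reflect each
coordinate until the offset of `b` is nonnegative. The final shift by 3 makes room for every cell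
touching `a`, since touching centres differ by at most 3. -/
theorem exists_sym_normal (a b : Cell) : ∃ e : Cell ≃ Cell, IsSym e ∧ e a = cellAt (false, 3, 3) ∧
    ∃ (r : Bool) (X Y : ℕ), e b = cellAt (r, 3 + X, 3 + Y) := by
  have h1 : ∃ e : Cell ≃ Cell, IsSym e ∧ e a = (0, 0, false) := by
    obtain ⟨u, v, _ | _⟩ := a
    · exact ⟨_, isSym_shift (-u) (-v), by simp [shiftCell]⟩
    · exact ⟨_, (isSym_shift (-u) (-v)).trans isSym_transpose, by
        simp [shiftCell, transposeCell]⟩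
  obtain ⟨e1, he1, ha1⟩ := h1
  have h2 : ∃ e : Cell ≃ Cell, IsSym e ∧ e a = (0, 0, false) ∧ 0 ≤ (e b).1 := by
    by_cases h : 0 ≤ (e1 b).1
    · exact ⟨e1, he1, ha1, h⟩
    · exact ⟨_, he1.trans isSym_reflectFst, by simp [ha1, reflectFst], by
        simp [reflectFst]; omega⟩
  obtain ⟨e2, he2, ha2, hb2⟩ := h2
  have h3 : ∃ e : Cell ≃ Cell, IsSym e ∧ e a = (0, 0, false) ∧ 0 ≤ (e b).1 ∧ 0 ≤ (e b).2.1 := by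
    by_cases h : 0 ≤ (e2 b).2.1
    · exact ⟨e2, he2, ha2, hb2, h⟩
    · exact ⟨_, he2.trans isSym_reflectSnd, by simp [ha2, reflectSnd], by
        simpa [reflectSnd] using hb2, by simp [reflectSnd]; omega⟩
  obtain ⟨e3, he3, ha3, hb3, hb3'⟩ := h3
  refine ⟨_, he3.trans (isSym_shift 3 3), by simp [ha3, shiftCell, cellAt], (e3 b).2.2,
    (e3 b).1.toNat, (e3 b).2.1.toNat, ?_⟩
  simp [shiftCell, cellAt, hb3, hb3', add_comm]

/-! ### The inequalities for all pairs of cells -/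

/-- Contribution of the next layer `{c, d}` above a connected partial building with top layer
`{a, b}`. -/
def joinedWeight (a b c d : Cell) : ℕ :=
  if (Touch a c ∨ Touch b c) ∧ (Touch a d ∨ Touch b d) then joinedTable.pot c d
  else if (Touch a c ∨ Touch b c) ∨ (Touch a d ∨ Touch b d) then splitTable.pot c d
  else 0

/-- Contribution of the next layer `{c, d}` above a partial building with two components and top
layer `{a, b}`. -/
def splitWeight (a b c d : Cell) : ℕ :=
  if (Touch a c ∨ Touch a d) ∧ (Touch b c ∨ Touch b d) then
    -- One new block bridges both components and the other is attached to at least one of them.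
    if (Touch a c ∧ Touch b c ∨ Touch a d ∧ Touch b d) ∧
        (Touch a c ∨ Touch b c) ∧ (Touch a d ∨ Touch b d) then joinedTable.pot c d
    else splitTable.pot c d
  else 0

/-- Number of cells touching one of two cells. -/
noncomputable def joinedCount (a b : Cell) : ℝ≥0∞ :=
  ∑' t, if Touch a t ∨ Touch b t then 1 else 0

/-- Number of cells touching both of two cells. -/
noncomputable def splitCount (a b : Cell) : ℝ≥0∞ :=
  ∑' t, if Touch a t ∧ Touch b t then 1 else 0

/-- Total contribution of the pairs in the next layer. -/
noncomputable def joinedSum (a b : Cell) : ℝ≥0∞ := ∑' c, ∑' d, (joinedWeight a b c d : ℝ≥0∞)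

/-- Total contribution of the pairs in the next layer. -/
noncomputable def splitSum (a b : Cell) : ℝ≥0∞ := ∑' c, ∑' d, (splitWeight a b c d : ℝ≥0∞)

namespace IsSym

variable {e : Cell ≃ Cell}

theorem joinedCount (he : IsSym e) (a b : Cell) :
    Lego.joinedCount (e a) (e b) = Lego.joinedCount a b := by
  rw [Lego.joinedCount, ← e.tsum_eq]
  simp only [he.touch]
  rfl

theorem splitCount (he : IsSym e) (a b : Cell) :
    Lego.splitCount (e a) (e b) = Lego.splitCount a b := by
  rw [Lego.splitCount, ← e.tsum_eq]
  simp only [he.touch]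
  rfl

theorem joinedSum (he : IsSym e) (a b : Cell) :
    Lego.joinedSum (e a) (e b) = Lego.joinedSum a b := by
  rw [Lego.joinedSum, ← e.tsum_eq, Lego.joinedSum]
  refine tsum_congr fun c => ?_
  rw [← e.tsum_eq]
  simp only [joinedWeight, he.touch, he.joined, he.split]

theorem splitSum (he : IsSym e) (a b : Cell) :
    Lego.splitSum (e a) (e b) = Lego.splitSum a b := by
  rw [Lego.splitSum, ← e.tsum_eq, Lego.splitSum]
  refine tsum_congr fun c => ?_
  rw [← e.tsum_eq]
  simp only [splitWeight, he.touch, he.joined, he.split]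

end IsSym

theorem near_iff (p : Bool × ℕ × ℕ) (r : Bool) (i j : ℕ) :
    near p r i j = true ↔ Touch (cellAt p) (cellAt (r, i, j)) := by
  simp only [near, Touch, cellAt, Bool.and_eq_true, Nat.blt_eq, natAbs_sub_cast]

theorem half_le (r : Bool) : half r ≤ 2 := by cases r <;> simp [half]

/-- Touching changes a coordinate by at most 3, so positions from 3 to 10 have all their neighbours
in the grid `0, …, 13`. -/
theorem exists_cellAt_of_touch {p : Bool × ℕ × ℕ} (h1 : 3 ≤ p.2.1) (h2 : p.2.1 < 11)
    (h3 : 3 ≤ p.2.2) (h4 : p.2.2 < 11) {c : Cell} (h : Touch (cellAt p) c) :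
    ∃ r, ∃ i < 14, ∃ j < 14, c = cellAt (r, i, j) := by
  obtain ⟨u, v, r⟩ := c
  obtain ⟨hx, hy⟩ := h
  have a1 := half_le p.1
  have a2 := half_le (!p.1)
  have a3 := half_le r
  have a4 := half_le (!r)
  simp only [cellAt] at hx hy
  refine ⟨r, u.toNat, by omega, v.toNat, by omega, ?_⟩
  simp only [cellAt, Prod.mk.injEq, and_true]
  omega

theorem mem_cells {f : Bool → ℕ → ℕ → Bool} {P : Cell → Prop}
    (h : ∀ r i j, f r i j = true ↔ P (cellAt (r, i, j)))
    (hP : ∀ c, P c → ∃ r, ∃ i < 14, ∃ j < 14, c = cellAt (r, i, j)) (c : Cell) :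
    c ∈ cells f ↔ P c := by
  simp only [cells, Finset.mem_map, Finset.mem_filter, Finset.mem_product, Finset.mem_univ,
    Finset.mem_range, true_and, Function.Embedding.coeFn_mk]
  constructor
  · rintro ⟨⟨r, i, j⟩, ⟨-, hf⟩, rfl⟩
    exact (h r i j).1 hf
  · intro hc
    obtain ⟨r, i, hi, j, hj, rfl⟩ := hP c hc
    exact ⟨(r, i, j), ⟨⟨hi, hj⟩, (h r i j).2 hc⟩, rfl⟩

theorem card_cells (f : Bool → ℕ → ℕ → Bool) : (cells f).card = count f := by
  rw [Finset.card_eq_sum_ones, sum_cells, count]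
  simp only [sumTo_eq, Finset.sum_product, Fintype.sum_bool, Finset.sum_add_distrib]
  generalize Finset.range 14 = R
  refine congr_arg₂ _ ?_ ?_ <;>
  · refine Finset.sum_congr rfl fun i _ => Finset.sum_congr rfl fun j _ => ?_
    split_ifs with h <;> simp [h]

/-- Double sum over two finite sets of cells. -/
theorem tsum_tsum_indicator (F G : Finset Cell) (w : Cell → Cell → ℕ) :
    ∑' c, ∑' d, ((if c ∈ F ∧ d ∈ G then w c d else 0 : ℕ) : ℝ≥0∞) =
      ((∑ c ∈ F, ∑ d ∈ G, w c d : ℕ) : ℝ≥0∞) := by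
  rw [tsum_eq_sum (s := F)]
  · push_cast
    refine Finset.sum_congr rfl fun c hc => ?_
    rw [tsum_eq_sum (s := G)]
    · exact Finset.sum_congr rfl fun d hd => by simp [hc, hd]
    · intro d hd; simp [hd]
  · intro c hc; simp [hc]

/-- The window of offsets from -7 to 7 supplies the whole constant; an inequality suffices for the
lower bound. -/
theorem le_tsum_split (c : Cell) : (39448 : ℝ≥0∞) ≤ ∑' d, (splitTable.pot c d : ℝ≥0∞) := by
  obtain ⟨u, v, r⟩ := c
  let g : Bool × ℕ × ℕ → Cell := fun p => (u + (p.2.1 - 7), v + (p.2.2 - 7), p.1)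
  have hg : Function.Injective g := by
    rintro ⟨r, i, j⟩ ⟨r', i', j'⟩ h
    simp only [g, Prod.mk.injEq] at h
    obtain ⟨h1, h2, rfl⟩ := h
    have h1' : i = i' := by omega
    have h2' : j = j' := by omega
    rw [h1', h2']
  have h1 : ∀ p, splitTable.pot (u, v, r) (g p) =
      splitTable.off r p.1 (gap p.2.1 7) (gap p.2.2 7) := by
    intro p
    have e1 : (u - (u + ((p.2.1 : ℤ) - 7))).natAbs = gap p.2.1 7 := by unfold gap; omega
    have e2 : (v - (v + ((p.2.2 : ℤ) - 7))).natAbs = gap p.2.2 7 := by unfold gap; omega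
    simp only [Table.pot, g, e1, e2]
  calc (39448 : ℝ≥0∞) = ((splitTotal r : ℕ) : ℝ≥0∞) := by rw [splitTotal_eq]; norm_num
    _ = ∑ p ∈ Finset.univ ×ˢ Finset.range 15 ×ˢ Finset.range 15,
          (splitTable.pot (u, v, r) (g p) : ℝ≥0∞) := by
        rw [← Nat.cast_sum]
        refine congrArg _ ?_
        simp only [h1, splitTotal, sumTo_eq, Finset.sum_product, Fintype.sum_bool,
          Finset.sum_add_distrib]
    _ ≤ ∑' p, (splitTable.pot (u, v, r) (g p) : ℝ≥0∞) := ENNReal.sum_le_tsum _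
    _ ≤ _ := ENNReal.tsum_comp_le_tsum_of_injective hg _

/-- Pairs with one member in `F` and the other outside of `S`. -/
theorem le_tsum_outside (F S : Finset Cell) :
    ((F.card * 39448 : ℕ) : ℝ≥0∞) ≤
      ∑' c, ∑' d, ((if c ∈ F ∧ d ∉ S then splitTable.pot c d else 0 : ℕ) : ℝ≥0∞) +
        ((∑ c ∈ F, ∑ d ∈ S, splitTable.pot c d : ℕ) : ℝ≥0∞) := by
  rw [← tsum_tsum_indicator, ← ENNReal.tsum_add]
  calc ((F.card * 39448 : ℕ) : ℝ≥0∞) = ∑ c ∈ F, 39448 := by simp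
    _ ≤ ∑ c ∈ F, ∑' d, (splitTable.pot c d : ℝ≥0∞) :=
        Finset.sum_le_sum fun c _ => le_tsum_split c
    _ = ∑ c ∈ F, (∑' d, ((if c ∈ F ∧ d ∉ S then splitTable.pot c d else 0 : ℕ) : ℝ≥0∞) +
          ∑' d, ((if c ∈ F ∧ d ∈ S then splitTable.pot c d else 0 : ℕ) : ℝ≥0∞)) := by
        refine Finset.sum_congr rfl fun c hc => ?_
        rw [← ENNReal.tsum_add]
        refine tsum_congr fun d => ?_
        by_cases hd : d ∈ S <;> simp [hc, hd]
    _ ≤ _ := ENNReal.sum_le_tsum _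

theorem tsum_tsum_swap (F S : Finset Cell) :
    ∑' c, ∑' d, ((if c ∉ S ∧ d ∈ F then splitTable.pot c d else 0 : ℕ) : ℝ≥0∞) =
      ∑' c, ∑' d, ((if c ∈ F ∧ d ∉ S then splitTable.pot c d else 0 : ℕ) : ℝ≥0∞) := by
  rw [ENNReal.tsum_comm]
  refine tsum_congr fun c => tsum_congr fun d => ?_
  rw [splitTable.pot_comm]
  simp only [and_comm]

/-- Replaces the computable bound `N - P` by the infinite sum `O` over pairs reaching outside.
Subtraction is avoided, and `O = ⊤` is harmless. -/
theorem ennreal_linear {A M J N P : ℕ} {O : ℝ≥0∞}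
    (h : A + 10000 * (2 * P) ≤ M + 10000 * (J + 2 * N)) (hO : (N : ℝ≥0∞) ≤ O + P) :
    (A : ℝ≥0∞) ≤ M + 10000 * (J + 2 * O) := by
  by_cases hT : O = ⊤
  · simp [hT]
  · lift O to NNReal using hT
    have hO' : (N : NNReal) ≤ O + P := by exact_mod_cast hO
    have hO'' : (N : ℝ) ≤ O + P := by exact_mod_cast hO'
    have h' : (A : ℝ) + 10000 * (2 * P) ≤ M + 10000 * (J + 2 * N) := by exact_mod_cast h
    have key : (A : NNReal) ≤ M + 10000 * (J + 2 * O) := by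
      rw [← NNReal.coe_le_coe]
      push_cast
      linarith
    exact_mod_cast key

theorem joinedCheck_spec {V : ℕ} {p q : Bool × ℕ × ℕ} (hp1 : 3 ≤ p.2.1) (hp2 : p.2.1 < 11)
    (hp3 : 3 ≤ p.2.2) (hp4 : p.2.2 < 11) (hq1 : 3 ≤ q.2.1) (hq2 : q.2.1 < 11)
    (hq3 : 3 ≤ q.2.2) (hq4 : q.2.2 < 11) (h : joinedCheck V p q = true) :
    ((2 * 7833 ^ 2 * V : ℕ) : ℝ≥0∞) ≤
      2 * 100 * 7833 * (1000 * joinedCount (cellAt p) (cellAt q)) +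
        10000 * joinedSum (cellAt p) (cellAt q) := by
  set a := cellAt p
  set b := cellAt q
  set S := cells fun r i j => near p r i j || near q r i j with hSdef
  have hS : ∀ c, c ∈ S ↔ Touch a c ∨ Touch b c := by
    refine mem_cells (fun r i j => ?_) fun c hc => ?_
    · rw [Bool.or_eq_true, near_iff, near_iff]
    · exact hc.elim (exists_cellAt_of_touch hp1 hp2 hp3 hp4)
        (exists_cellAt_of_touch hq1 hq2 hq3 hq4)
  set O := ∑' c, ∑' d, ((if c ∈ S ∧ d ∉ S then splitTable.pot c d else 0 : ℕ) : ℝ≥0∞) with hO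
  have hcount : joinedCount a b = (S.card : ℝ≥0∞) := by
    rw [joinedCount, tsum_eq_sum (s := S)]
    · rw [Finset.sum_congr rfl fun t ht => if_pos ((hS t).1 ht)]
      simp
    · intro t ht
      exact if_neg fun h => ht ((hS t).2 h)
  -- Split a pair by membership in `S`: both members give the joined potential, exactly one gives
  -- the split potential, and the two mixed cases agree by symmetry.
  have hsum : joinedSum a b = ((∑ c ∈ S, ∑ d ∈ S, joinedTable.pot c d : ℕ) : ℝ≥0∞) + 2 * O := by
    have h1 : ∀ c d, (joinedWeight a b c d : ℝ≥0∞) =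
        ((if c ∈ S ∧ d ∈ S then joinedTable.pot c d else 0 : ℕ) : ℝ≥0∞) +
        (((if c ∈ S ∧ d ∉ S then splitTable.pot c d else 0 : ℕ) : ℝ≥0∞) +
          ((if c ∉ S ∧ d ∈ S then splitTable.pot c d else 0 : ℕ) : ℝ≥0∞)) := by
      intro c d
      rw [joinedWeight]
      simp only [← hS]
      by_cases hc : c ∈ S <;> by_cases hd : d ∈ S <;> simp [hc, hd]
    simp only [joinedSum, h1, ENNReal.tsum_add]
    rw [tsum_tsum_indicator, tsum_tsum_swap, ← hO, two_mul]
  have hout := le_tsum_outside S S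
  rw [← hO] at hout
  have h' := Nat.le_of_ble_eq_true h
  simp only [joinedTable.pairSum_eq le_rfl joinedTable_small,
    splitTable.pairSum_eq le_rfl splitTable_small, ← card_cells, ← hSdef] at h'
  have := ennreal_linear h' hout
  rw [hcount, hsum]
  refine this.trans (le_of_eq ?_)
  push_cast
  ring

theorem splitCheck_spec {V : ℕ} {p q : Bool × ℕ × ℕ} (hp1 : 3 ≤ p.2.1) (hp2 : p.2.1 < 11)
    (hp3 : 3 ≤ p.2.2) (hp4 : p.2.2 < 11) (hq1 : 3 ≤ q.2.1) (hq2 : q.2.1 < 11)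
    (hq3 : 3 ≤ q.2.2) (hq4 : q.2.2 < 11) (h : splitCheck V p q = true) :
    ((2 * 7833 ^ 2 * V : ℕ) : ℝ≥0∞) ≤
      2 * 100 * 7833 * (1000 * splitCount (cellAt p) (cellAt q)) +
        10000 * splitSum (cellAt p) (cellAt q) := by
  set a := cellAt p
  set b := cellAt q
  have hp : ∀ c, Touch a c → ∃ r, ∃ i < 14, ∃ j < 14, c = cellAt (r, i, j) := fun c =>
    exists_cellAt_of_touch hp1 hp2 hp3 hp4
  have hq : ∀ c, Touch b c → ∃ r, ∃ i < 14, ∃ j < 14, c = cellAt (r, i, j) := fun c =>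
    exists_cellAt_of_touch hq1 hq2 hq3 hq4
  set S := cells fun r i j => near p r i j || near q r i j with hSdef
  set J := cells fun r i j => near p r i j && near q r i j with hJdef
  set A := cells fun r i j => near p r i j && !near q r i j with hAdef
  set B := cells fun r i j => near q r i j && !near p r i j with hBdef
  set X := cells fun r i j => near p r i j ^^ near q r i j with hXdef
  have hS : ∀ c, c ∈ S ↔ Touch a c ∨ Touch b c := by
    refine mem_cells (fun r i j => ?_) fun c hc => hc.elim (hp c) (hq c)
    rw [Bool.or_eq_true, near_iff, near_iff]
  have hJ : ∀ c, c ∈ J ↔ Touch a c ∧ Touch b c := by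
    refine mem_cells (fun r i j => ?_) fun c hc => hp c hc.1
    rw [Bool.and_eq_true, near_iff, near_iff]
  have hA : ∀ c, c ∈ A ↔ Touch a c ∧ ¬ Touch b c := by
    refine mem_cells (fun r i j => ?_) fun c hc => hp c hc.1
    rw [Bool.and_eq_true, Bool.not_eq_true', ← Bool.not_eq_true, near_iff, near_iff]
  have hB : ∀ c, c ∈ B ↔ Touch b c ∧ ¬ Touch a c := by
    refine mem_cells (fun r i j => ?_) fun c hc => hq c hc.1
    rw [Bool.and_eq_true, Bool.not_eq_true', ← Bool.not_eq_true, near_iff, near_iff]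
  have hX : ∀ c, c ∈ X ↔ Xor (Touch a c) (Touch b c) := by
    refine mem_cells (fun r i j => ?_) fun c hc => hc.elim (fun h => hp c h.1) fun h => hq c h.1
    rw [← near_iff, ← near_iff]
    cases near p r i j <;> cases near q r i j <;> simp [Xor]
  set O := ∑' c, ∑' d, ((if c ∈ J ∧ d ∉ S then splitTable.pot c d else 0 : ℕ) : ℝ≥0∞) with hO
  have hcount : splitCount a b = (J.card : ℝ≥0∞) := by
    rw [splitCount, tsum_eq_sum (s := J)]
    · rw [Finset.sum_congr rfl fun t ht => if_pos ((hJ t).1 ht)]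
      simp
    · intro t ht
      exact if_neg fun h => ht ((hJ t).2 h)
  have hsum : ((∑ c ∈ J, ∑ d ∈ S, joinedTable.pot c d : ℕ) : ℝ≥0∞) +
      (((∑ c ∈ X, ∑ d ∈ J, joinedTable.pot c d : ℕ) : ℝ≥0∞) +
      (((∑ c ∈ A, ∑ d ∈ B, splitTable.pot c d : ℕ) : ℝ≥0∞) +
      ((∑ c ∈ A, ∑ d ∈ B, splitTable.pot c d : ℕ) : ℝ≥0∞) + (O + O))) = splitSum a b := by
    -- The sixteen contact patterns between `a`, `b` and `c`, `d` fall into these disjoint classes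
    -- or contribute nothing.
    have h1 : ∀ c d, (splitWeight a b c d : ℝ≥0∞) =
        ((if c ∈ J ∧ d ∈ S then joinedTable.pot c d else 0 : ℕ) : ℝ≥0∞) +
        (((if c ∈ X ∧ d ∈ J then joinedTable.pot c d else 0 : ℕ) : ℝ≥0∞) +
        (((if c ∈ A ∧ d ∈ B then splitTable.pot c d else 0 : ℕ) : ℝ≥0∞) +
        ((if c ∈ B ∧ d ∈ A then splitTable.pot c d else 0 : ℕ) : ℝ≥0∞) +
        (((if c ∈ J ∧ d ∉ S then splitTable.pot c d else 0 : ℕ) : ℝ≥0∞) +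
          ((if c ∉ S ∧ d ∈ J then splitTable.pot c d else 0 : ℕ) : ℝ≥0∞)))) := by
      intro c d
      rw [splitWeight]
      simp only [hS, hJ, hA, hB, hX, Xor]
      by_cases h1 : Touch a c <;> by_cases h2 : Touch b c <;> by_cases h3 : Touch a d <;>
        by_cases h4 : Touch b d <;> simp [h1, h2, h3, h4]
    have hBA : ∑ c ∈ B, ∑ d ∈ A, splitTable.pot c d = ∑ c ∈ A, ∑ d ∈ B, splitTable.pot c d := by
      rw [Finset.sum_comm]
      exact Finset.sum_congr rfl fun c _ => Finset.sum_congr rfl fun d _ =>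
        splitTable.pot_comm _ _
    simp only [splitSum, h1, ENNReal.tsum_add]
    simp only [tsum_tsum_indicator, tsum_tsum_swap, ← hO, hBA]
  have hout := le_tsum_outside J S
  rw [← hO] at hout
  have h' := Nat.le_of_ble_eq_true h
  simp only [joinedTable.pairSum_eq le_rfl joinedTable_small,
    splitTable.pairSum_eq le_rfl splitTable_small, ← card_cells, ← hSdef, ← hJdef, ← hAdef,
    ← hBdef, ← hXdef] at h'
  have := ennreal_linear h' hout
  rw [hcount, ← hsum]
  refine this.trans (le_of_eq ?_)
  push_cast
  ring

theorem single_inequality (a : Cell) : ((2 * 7833 ^ 2 * 1000 : ℕ) : ℝ≥0∞) ≤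
    2 * 100 * 7833 * (1000 * joinedCount a a) + 10000 * joinedSum a a := by
  obtain ⟨e, he, ha, -⟩ := exists_sym_normal a a
  rw [← he.joinedCount, ← he.joinedSum, ha]
  exact joinedCheck_spec (by norm_num) (by norm_num) (by norm_num) (by norm_num) (by norm_num)
    (by norm_num) (by norm_num) (by norm_num) joinedCheck_single

theorem pot_cellAt (T : Table) (r : Bool) (X Y : ℕ) :
    T.pot (cellAt (false, 3, 3)) (cellAt (r, 3 + X, 3 + Y)) = T.off false r X Y := by
  have h : ∀ n : ℕ, gap 3 (3 + n) = n := fun n => by unfold gap; omega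
  simp only [Table.pot, cellAt, natAbs_sub_cast, h]

theorem joined_inequality (a b : Cell) : ((2 * 7833 ^ 2 * joinedTable.pot a b : ℕ) : ℝ≥0∞) ≤
    2 * 100 * 7833 * (1000 * joinedCount a b) + 10000 * joinedSum a b := by
  obtain ⟨e, he, ha, r, X, Y, hb⟩ := exists_sym_normal a b
  rw [← he.joinedCount, ← he.joinedSum, ← he.joined, ha, hb, pot_cellAt]
  by_cases h : X < 8 ∧ Y < 8
  · refine joinedCheck_spec ?_ ?_ ?_ ?_ ?_ ?_ ?_ ?_ ?_
    iterate 8 (dsimp only; omega)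
    cases r
    · exact allTo_spec (allTo_spec joinedCheck_same h.1) h.2
    · exact allTo_spec (allTo_spec joinedCheck_mixed h.1) h.2
  · rw [Table.off_eq_zero _ _ _ (by omega)]
    simp

theorem split_inequality (a b : Cell) : ((2 * 7833 ^ 2 * splitTable.pot a b : ℕ) : ℝ≥0∞) ≤
    2 * 100 * 7833 * (1000 * splitCount a b) + 10000 * splitSum a b := by
  obtain ⟨e, he, ha, r, X, Y, hb⟩ := exists_sym_normal a b
  rw [← he.splitCount, ← he.splitSum, ← he.split, ha, hb, pot_cellAt]
  by_cases h : X < 8 ∧ Y < 8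
  · refine splitCheck_spec ?_ ?_ ?_ ?_ ?_ ?_ ?_ ?_ ?_
    iterate 8 (dsimp only; omega)
    cases r
    · exact allTo_spec (allTo_spec splitCheck_same h.1) h.2
    · exact allTo_spec (allTo_spec splitCheck_mixed h.1) h.2
  · rw [Table.off_eq_zero _ _ _ (by omega)]
    simp

/-- This allows the weighted sums to run over all ordered pairs: colliding or equal blocks
contribute nothing. -/
theorem pot_eq_zero_of_touch {a b : Cell} (h : Touch a b) :
    joinedTable.pot a b = 0 ∧ splitTable.pot a b = 0 := by
  obtain ⟨e, he, ha, r, X, Y, hb⟩ := exists_sym_normal a b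
  rw [← he.joined, ← he.split, ha, hb, pot_cellAt, pot_cellAt]
  rw [← he.touch, ha, hb] at h
  obtain ⟨h1, h2⟩ := h
  simp only [cellAt, natAbs_sub_cast, gap] at h1 h2
  have key : ∀ r, ∀ X < half false + half r, ∀ Y < half true + half (!r),
      joinedTable.off false r X Y = 0 ∧ splitTable.off false r X Y = 0 := by decide +kernel
  refine key r X ?_ Y ?_
  · omega
  · simp only [Bool.not_false] at h2; omega

/-! ### Links inside a set of blocks -/

/-- The two blocks belong to `s` and are connected inside `s`. -/
def Link (s : Finset Block) (c d : Block) : Prop :=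
  ∃ (hc : c ∈ s) (hd : d ∈ s),
    (attachGraph.induce (s : Set Block)).Reachable ⟨c, hc⟩ ⟨d, hd⟩

namespace Link

variable {s t : Finset Block} {b c d : Block}

theorem refl (hc : c ∈ s) : Link s c c := ⟨hc, hc, .rfl⟩

theorem symm (h : Link s c d) : Link s d c := by
  obtain ⟨hc, hd, h⟩ := h
  exact ⟨hd, hc, h.symm⟩

theorem trans (h : Link s b c) (h' : Link s c d) : Link s b d := by
  obtain ⟨hb, hc, h⟩ := h
  obtain ⟨_, hd, h'⟩ := h'
  exact ⟨hb, hd, h.trans h'⟩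

theorem of_adj (hc : c ∈ s) (hd : d ∈ s) (h : attachGraph.Adj c d) : Link s c d :=
  ⟨hc, hd, SimpleGraph.Adj.reachable (by simpa using h)⟩

theorem mono (hst : s ⊆ t) (h : Link s c d) : Link t c d := by
  obtain ⟨hc, hd, h⟩ := h
  exact ⟨hst hc, hst hd,
    h.map (SimpleGraph.induceHomOfLE attachGraph (Finset.coe_subset.2 hst)).toHom⟩

theorem image {f : Block → Block} (hf : ∀ c d, attachGraph.Adj c d → attachGraph.Adj (f c) (f d))
    (h : Link s c d) : Link (s.image f) (f c) (f d) := by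
  obtain ⟨hc, hd, ⟨p⟩⟩ := h
  suffices H : ∀ (u v : (s : Set Block)) (p : (attachGraph.induce (s : Set Block)).Walk u v),
      Link (s.image f) (f u) (f v) from H _ _ p
  intro u v p
  induction p with
  | nil => exact refl (Finset.mem_image_of_mem _ (Subtype.property _))
  | cons h p ih =>
    exact (of_adj (Finset.mem_image_of_mem _ (Subtype.property _))
      (Finset.mem_image_of_mem _ (Subtype.property _)) (hf _ _ h)).trans ih

end Link

theorem connected_of_link {s : Finset Block} {a : Block} (ha : a ∈ s) (h : ∀ c ∈ s, Link s c a) :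
    (attachGraph.induce (s : Set Block)).Connected := by
  have : Nonempty (s : Set Block) := ⟨⟨a, ha⟩⟩
  refine ⟨fun u v => ?_⟩
  obtain ⟨_, _, h1⟩ := h u u.2
  obtain ⟨_, _, h2⟩ := h v v.2
  exact h1.trans h2.symm

theorem IsBuilding.link {s : Finset Block} (h : IsBuilding s) {c d : Block} (hc : c ∈ s)
    (hd : d ∈ s) : Link s c d := ⟨hc, hd, h.2.preconnected _ _⟩

theorem IsBuilding.nonempty {s : Finset Block} (h : IsBuilding s) : s.Nonempty := by
  obtain ⟨a, ha⟩ := h.2.nonempty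
  exact ⟨a, ha⟩

/-! ### Blocks over a cell -/

/-- The block in layer `h` over a cell. -/
def blockAt (h : ℤ) (a : Cell) : Block :=
  ⟨a.1 - half a.2.2, a.2.1 - half (!a.2.2), h, a.2.2⟩

@[simp] theorem blockAt_z (h : ℤ) (a : Cell) : (blockAt h a).z = h := rfl

theorem blockAt_injective (h : ℤ) : Function.Injective (blockAt h) := by
  rintro ⟨u, v, r⟩ ⟨u', v', r'⟩ e
  simp only [blockAt, Block.mk.injEq, true_and] at e
  obtain ⟨h1, h2, rfl⟩ := e
  simp_all

theorem overlap_blockAt (h h' : ℤ) (a b : Cell) :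
    (blockAt h a).Overlap (blockAt h' b) ↔ Touch a b := by
  obtain ⟨u, v, _ | _⟩ := a <;> obtain ⟨u', v', _ | _⟩ := b <;>
    simp only [Block.Overlap, blockAt, Touch, half, Block.lenX, Block.lenY, Bool.not_true,
      Bool.not_false, cond_true, cond_false, Bool.false_eq_true, if_true, if_false] <;>
    omega

theorem Touch.symm {a b : Cell} (h : Touch a b) : Touch b a := by
  unfold Touch at *
  omega

theorem touch_self (a : Cell) : Touch a a := by
  obtain ⟨u, v, _ | _⟩ := a <;> simp [Touch, half]

theorem adj_blockAt {h : ℤ} {a b : Cell} (hab : Touch a b) :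
    attachGraph.Adj (blockAt h a) (blockAt (h + 1) b) :=
  Or.inr ⟨rfl, (overlap_blockAt _ _ _ _).2 hab.symm⟩

/-! ### Partial buildings -/

/-- Blocks in layers up to `h`, pairwise not colliding, with top layer over the cells `L`. -/
structure IsPartial (h : ℤ) (L : Finset Cell) (s : Finset Block) : Prop where
  disjoint : ∀ c ∈ s, ∀ d ∈ s, c ≠ d → ¬ c.Collide d
  le : ∀ c ∈ s, c.z ≤ h
  mem : ∀ a ∈ L, blockAt h a ∈ s

theorem IsPartial.union {h : ℤ} {L L' : Finset Cell} {s : Finset Block} (hs : IsPartial h L s)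
    (hL' : ∀ a ∈ L', ∀ b ∈ L', a ≠ b → ¬ Touch a b) :
    IsPartial (h + 1) L' (s ∪ L'.image (blockAt (h + 1))) where
  disjoint c hc d hd hcd hcol := by
    rw [Finset.mem_union, Finset.mem_image] at hc hd
    rcases hc with hc | ⟨a, ha, rfl⟩ <;> rcases hd with hd | ⟨b, hb, rfl⟩
    · exact hs.disjoint c hc d hd hcd hcol
    · have := hs.le c hc
      have := hcol.1
      simp at this
      omega
    · have := hs.le d hd
      have := hcol.1
      simp at this
      omega
    · exact hL' a ha b hb (fun e => hcd (by rw [e])) ((overlap_blockAt _ _ _ _).1 hcol.2)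
  le c hc := by
    rw [Finset.mem_union, Finset.mem_image] at hc
    rcases hc with hc | ⟨a, ha, rfl⟩
    · have := hs.le c hc; omega
    · simp
  mem a ha := Finset.mem_union_right _ (Finset.mem_image_of_mem _ ha)

/-- A partial building with top layer over `a` and `b` (which may agree), all of whose blocks are
linked to `a` or to `b`. -/
def IsSplit (h : ℤ) (a b : Cell) (s : Finset Block) : Prop :=
  IsPartial h {a, b} s ∧ ∀ c ∈ s, Link s c (blockAt h a) ∨ Link s c (blockAt h b)

/-- A connected partial building with top layer over `a` and `b` (which may agree). -/
def IsJoined (h : ℤ) (a b : Cell) (s : Finset Block) : Prop :=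
  IsPartial h {a, b} s ∧ ∀ c ∈ s, Link s c (blockAt h a)

/-- Adding a layer of two blocks, which may agree. -/
def addLayer (h : ℤ) (c d : Cell) (s : Finset Block) : Finset Block :=
  s ∪ ({c, d} : Finset Cell).image (blockAt (h + 1))

section

variable {h : ℤ} {a b c d : Cell} {s : Finset Block}

theorem subset_addLayer : s ⊆ addLayer h c d s := Finset.subset_union_left

theorem left_mem_addLayer : blockAt (h + 1) c ∈ addLayer h c d s :=
  Finset.mem_union_right _ (Finset.mem_image_of_mem _ (by simp))

theorem right_mem_addLayer : blockAt (h + 1) d ∈ addLayer h c d s :=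
  Finset.mem_union_right _ (Finset.mem_image_of_mem _ (by simp))

theorem mem_addLayer {e : Block} : e ∈ addLayer h c d s ↔
    e ∈ s ∨ e = blockAt (h + 1) c ∨ e = blockAt (h + 1) d := by
  simp only [addLayer, Finset.mem_union, Finset.image_insert, Finset.image_singleton,
    Finset.mem_insert, Finset.mem_singleton]

theorem isPartial_addLayer {L : Finset Cell} (hs : IsPartial h L s) (hcd : c = d ∨ ¬ Touch c d) :
    IsPartial (h + 1) {c, d} (addLayer h c d s) := by
  refine hs.union fun x hx y hy hxy => ?_
  simp only [Finset.mem_insert, Finset.mem_singleton] at hx hy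
  rcases hcd with rfl | hcd
  · simp only [or_self] at hx hy
    exact absurd (hx.trans hy.symm) hxy
  · rcases hx with rfl | rfl <;> rcases hy with rfl | rfl
    · exact absurd rfl hxy
    · exact hcd
    · exact fun e => hcd e.symm
    · exact absurd rfl hxy

theorem addLayer_comm : addLayer h c d s = addLayer h d c s := by
  rw [addLayer, addLayer, Finset.pair_comm]

theorem IsJoined.isSplit (hs : IsJoined h a b s) : IsSplit h a b s :=
  ⟨hs.1, fun c hc => Or.inl (hs.2 c hc)⟩

theorem link_left (ha : blockAt h a ∈ s) (hac : Touch a c) :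
    Link (addLayer h c d s) (blockAt h a) (blockAt (h + 1) c) :=
  Link.of_adj (subset_addLayer ha) left_mem_addLayer (adj_blockAt hac)

theorem link_right (ha : blockAt h a ∈ s) (had : Touch a d) :
    Link (addLayer h c d s) (blockAt h a) (blockAt (h + 1) d) :=
  Link.of_adj (subset_addLayer ha) right_mem_addLayer (adj_blockAt had)

/-- If both top blocks of a partial building carry a block, every block is linked to the next
layer. -/
theorem IsSplit.addLayer_split (hs : IsSplit h a b s) (hcd : c = d ∨ ¬ Touch c d)
    (ha : Touch a c ∨ Touch a d) (hb : Touch b c ∨ Touch b d) :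
    IsSplit (h + 1) c d (addLayer h c d s) := by
  refine ⟨isPartial_addLayer hs.1 hcd, fun e he => ?_⟩
  have ma := hs.1.mem a (by simp)
  have mb := hs.1.mem b (by simp)
  rcases mem_addLayer.1 he with he | rfl | rfl
  · rcases hs.2 e he with hl | hl
    · exact ha.imp (fun h => (hl.mono subset_addLayer).trans (link_left ma h))
        (fun h => (hl.mono subset_addLayer).trans (link_right ma h))
    · exact hb.imp (fun h => (hl.mono subset_addLayer).trans (link_left mb h))
        (fun h => (hl.mono subset_addLayer).trans (link_right mb h))
  · exact Or.inl (Link.refl he)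
  · exact Or.inr (Link.refl he)

/-- If one block of the next layer sits on both top blocks and the other one sits on at least one of
them, the result is connected. -/
theorem IsSplit.addLayer_joined (hs : IsSplit h a b s) (hcd : c = d ∨ ¬ Touch c d)
    (hac : Touch a c) (hbc : Touch b c) (hd : Touch a d ∨ Touch b d) :
    IsJoined (h + 1) c d (addLayer h c d s) := by
  refine ⟨isPartial_addLayer hs.1 hcd, fun e he => ?_⟩
  have ma := hs.1.mem a (by simp)
  have mb := hs.1.mem b (by simp)
  rcases mem_addLayer.1 he with he | rfl | rfl
  · rcases hs.2 e he with hl | hl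
    · exact (hl.mono subset_addLayer).trans (link_left ma hac)
    · exact (hl.mono subset_addLayer).trans (link_left mb hbc)
  · exact Link.refl he
  · rcases hd with hd | hd
    · exact (link_right ma hd).symm.trans (link_left ma hac)
    · exact (link_right mb hd).symm.trans (link_left mb hbc)

theorem IsJoined.comm (hs : IsJoined h a b s) : IsJoined h b a s := by
  refine ⟨by rw [Finset.pair_comm]; exact hs.1, fun c hc => ?_⟩
  exact (hs.2 c hc).trans (hs.2 _ (hs.1.mem b (by simp))).symm

/-- `IsPartial` only requires the listed cells to be occupied in the top layer, so `b` may be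
dropped. When everything is connected, covering one top block is enough. -/
theorem IsJoined.split_left (hs : IsJoined h a b s) : IsSplit h a a s := by
  refine ⟨⟨hs.1.disjoint, hs.1.le, fun x hx => hs.1.mem x ?_⟩, fun c hc => Or.inl (hs.2 c hc)⟩
  simp only [Finset.pair_eq_singleton, Finset.mem_singleton] at hx
  simp [hx]

theorem IsJoined.split_right (hs : IsJoined h a b s) : IsSplit h b b s := hs.comm.split_left

/-- Connected partial buildings with at least one block over the top layer. -/
theorem IsJoined.addLayer_split (hs : IsJoined h a b s) (hcd : c = d ∨ ¬ Touch c d)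
    (hc : (Touch a c ∨ Touch b c) ∨ (Touch a d ∨ Touch b d)) :
    IsSplit (h + 1) c d (addLayer h c d s) := by
  rcases hc with (h | h) | (h | h)
  · exact hs.split_left.addLayer_split hcd (Or.inl h) (Or.inl h)
  · exact hs.split_right.addLayer_split hcd (Or.inl h) (Or.inl h)
  · exact hs.split_left.addLayer_split hcd (Or.inr h) (Or.inr h)
  · exact hs.split_right.addLayer_split hcd (Or.inr h) (Or.inr h)

theorem IsJoined.addLayer_joined (hs : IsJoined h a b s) (hcd : c = d ∨ ¬ Touch c d)
    (hc : Touch a c ∨ Touch b c) (hd : Touch a d ∨ Touch b d) :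
    IsJoined (h + 1) c d (addLayer h c d s) := by
  refine ⟨isPartial_addLayer hs.1 hcd, fun e he => ?_⟩
  have ma := hs.1.mem a (by simp)
  have mb := hs.1.mem b (by simp)
  have hab : Link (addLayer h c d s) (blockAt h b) (blockAt h a) := (hs.2 _ mb).mono subset_addLayer
  have hca : Link (addLayer h c d s) (blockAt h a) (blockAt (h + 1) c) := by
    rcases hc with h | h
    · exact link_left ma h
    · exact hab.symm.trans (link_left mb h)
  have hda : Link (addLayer h c d s) (blockAt h a) (blockAt (h + 1) d) := by
    rcases hd with h | h
    · exact link_right ma h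
    · exact hab.symm.trans (link_right mb h)
  rcases mem_addLayer.1 he with he | rfl | rfl
  · exact ((hs.2 e he).mono subset_addLayer).trans hca
  · exact Link.refl he
  · exact hda.symm.trans hca

theorem IsJoined.isBuilding (hs : IsJoined h a b s) : IsBuilding s :=
  ⟨hs.1.disjoint, connected_of_link (hs.1.mem a (by simp)) hs.2⟩

theorem filter_addLayer (hs : ∀ e ∈ s, e.z ≤ h) : (addLayer h c d s).filter (·.z ≤ h) = s := by
  ext e
  rw [Finset.mem_filter, mem_addLayer]
  constructor
  · rintro ⟨he | rfl | rfl, hz⟩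
    · exact he
    · simp at hz
    · simp at hz
  · exact fun he => ⟨Or.inl he, hs e he⟩

theorem blockAt_notMem (hs : ∀ e ∈ s, e.z ≤ h) : blockAt (h + 1) c ∉ s := fun hc => by
  have := hs _ hc
  simp at this

theorem card_addLayer_self (hs : ∀ e ∈ s, e.z ≤ h) : (addLayer h c c s).card = s.card + 1 := by
  have : addLayer h c c s = insert (blockAt (h + 1) c) s := by
    ext e; simp [mem_addLayer, or_comm]
  rw [this, Finset.card_insert_of_notMem (blockAt_notMem hs)]

theorem card_addLayer (hs : ∀ e ∈ s, e.z ≤ h) (hcd : c ≠ d) :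
    (addLayer h c d s).card = s.card + 2 := by
  have : addLayer h c d s = insert (blockAt (h + 1) c) (insert (blockAt (h + 1) d) s) := by
    ext e
    simp only [mem_addLayer, Finset.mem_insert]
    tauto
  rw [this, Finset.card_insert_of_notMem, Finset.card_insert_of_notMem (blockAt_notMem hs)]
  rw [Finset.mem_insert, not_or]
  exact ⟨fun e => hcd (blockAt_injective _ e), blockAt_notMem hs⟩

/-- The new layer is recovered by removing `s`, but only as an unordered pair; this is the source of
the factor `1 / 2` in the weighted sums. -/
theorem addLayer_inj {c' d' : Cell} (hs : ∀ e ∈ s, e.z ≤ h)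
    (e : addLayer h c d s = addLayer h c' d' s) : c = c' ∧ d = d' ∨ c = d' ∧ d = c' := by
  have key : ({c, d} : Finset Cell) = {c', d'} := by
    have h1 : ∀ L : Finset Cell, (s ∪ L.image (blockAt (h + 1))) \ s = L.image (blockAt (h + 1)) :=
      fun L => by
        rw [Finset.union_sdiff_left, Finset.sdiff_eq_self_iff_disjoint, Finset.disjoint_left]
        intro x hx hxs
        obtain ⟨y, -, rfl⟩ := Finset.mem_image.1 hx
        exact blockAt_notMem hs hxs
    have h2 := congrArg (· \ s) e
    simp only [addLayer, h1] at h2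
    exact Finset.image_injective (blockAt_injective _) h2
  have hc : c ∈ ({c', d'} : Finset Cell) := key ▸ by simp
  have hd : d ∈ ({c', d'} : Finset Cell) := key ▸ by simp
  have hc' : c' ∈ ({c, d} : Finset Cell) := key ▸ by simp
  have hd' : d' ∈ ({c, d} : Finset Cell) := key ▸ by simp
  simp only [Finset.mem_insert, Finset.mem_singleton] at hc hd hc' hd'
  grind

end

/-- Every partial building with two components can be completed to a building. -/
theorem IsSplit.exists_completion (n : ℕ) : ∀ {h : ℤ} {a b : Cell} {s : Finset Block},
    IsSplit h a b s → (a.1 - b.1).natAbs + (a.2.1 - b.2.1).natAbs ≤ n →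
    ∃ u, IsBuilding u ∧ u.filter (·.z ≤ h) = s ∧ u.card ≤ s.card + 2 * n + 1 := by
  induction n with
  | zero =>
    intro h a b s hs hn
    have hab : Touch a b := by
      have h1 : (a.1 - b.1).natAbs = 0 := by omega
      have h2 : (a.2.1 - b.2.1).natAbs = 0 := by omega
      rw [Touch, h1, h2]
      cases a.2.2 <;> cases b.2.2 <;> simp [half]
    refine ⟨addLayer h a a s, ?_, filter_addLayer hs.1.le, by rw [card_addLayer_self hs.1.le]⟩
    exact (hs.addLayer_joined (Or.inl rfl) (touch_self a) hab.symm
      (Or.inl (touch_self a))).isBuilding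
  | succ n ih =>
    intro h a b s hs hn
    by_cases hc : ∃ c, Touch a c ∧ Touch b c
    · obtain ⟨c, hac, hbc⟩ := hc
      refine ⟨addLayer h c c s, ?_, filter_addLayer hs.1.le,
        by rw [card_addLayer_self hs.1.le]; omega⟩
      exact (hs.addLayer_joined (Or.inl rfl) hac hbc (Or.inl hac)).isBuilding
    · have hmove : ∃ c, Touch a c ∧ (c.1 - b.1).natAbs + (c.2.1 - b.2.1).natAbs ≤ n := by
        have hne : a.1 ≠ b.1 ∨ a.2.1 ≠ b.2.1 := by
          by_contra! hcon
          refine hc ⟨a, touch_self a, ?_⟩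
          rw [Touch, hcon.1, hcon.2]
          cases a.2.2 <;> cases b.2.2 <;> simp [half]
        have hh : ∀ r : Bool, 1 ≤ half r := by decide
        have p1 := hh a.2.2
        have p2 := hh (!a.2.2)
        rcases hne with hne | hne
        · rcases lt_or_gt_of_ne hne with hlt | hlt
          · exact ⟨(a.1 + 1, a.2), by unfold Touch; dsimp only; omega, by dsimp only; omega⟩
          · exact ⟨(a.1 - 1, a.2), by unfold Touch; dsimp only; omega, by dsimp only; omega⟩
        · rcases lt_or_gt_of_ne hne with hlt | hlt
          · exact ⟨(a.1, a.2.1 + 1, a.2.2), by unfold Touch; dsimp only; omega,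
              by dsimp only; omega⟩
          · exact ⟨(a.1, a.2.1 - 1, a.2.2), by unfold Touch; dsimp only; omega,
              by dsimp only; omega⟩
      obtain ⟨c, hac, hcn⟩ := hmove
      have hcb : ¬ Touch c b := fun hcb => hc ⟨c, hac, hcb.symm⟩
      have hne : c ≠ b := fun e => hcb (e ▸ touch_self c)
      obtain ⟨u, hu, huf, hcard⟩ := ih
        (hs.addLayer_split (Or.inr hcb) (Or.inl hac) (Or.inr (touch_self b))) hcn
      refine ⟨u, hu, ?_, ?_⟩
      · rw [← filter_addLayer (c := c) (d := b) hs.1.le, ← huf, Finset.filter_filter]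
        refine Finset.filter_congr fun e _ => ?_
        constructor
        · intro he; exact ⟨by omega, he⟩
        · exact fun he => he.2
      · rw [card_addLayer hs.1.le hne] at hcard
        omega

/-! ### Weighted sums over the buildings extending a partial building -/

/-- Weight of a block. -/
noncomputable def rate : ℝ≥0∞ := 100 / 7833

theorem rate_mul : 7833 * rate = 100 := ENNReal.mul_div_cancel (by norm_num) (by norm_num)

theorem rate_le_one : rate ≤ 1 := ENNReal.div_le_of_le_mul (by norm_num)

theorem rate_pos : 0 < rate := ENNReal.div_pos (by norm_num) (by norm_num)

/-- Returns from the integer form of the checks to the weighted form by cancelling `2 * 7833 ^ 2`.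
-/
theorem le_of_scaled {V : ℕ} {n W : ℝ≥0∞} (h : ((2 * 7833 ^ 2 * V : ℕ) : ℝ≥0∞) ≤
    2 * 100 * 7833 * (1000 * n) + 10000 * W) :
    (V : ℝ≥0∞) ≤ rate * (1000 * n) + rate ^ 2 / 2 * W := by
  have hC0 : (2 * 7833 ^ 2 : ℝ≥0∞) ≠ 0 := by norm_num
  have hCt : (2 * 7833 ^ 2 : ℝ≥0∞) ≠ ⊤ := by finiteness
  rw [← ENNReal.mul_le_mul_iff_right hC0 hCt]
  have h2 : (2 : ℝ≥0∞) * 2⁻¹ = 1 := ENNReal.mul_inv_cancel (by norm_num) (by norm_num)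
  calc (2 * 7833 ^ 2 * V : ℝ≥0∞) = ((2 * 7833 ^ 2 * V : ℕ) : ℝ≥0∞) := by push_cast; norm_num
    _ ≤ _ := h
    _ = 2 * (7833 * rate) * 7833 * (1000 * n) + (7833 * rate) * (7833 * rate) * (2 * 2⁻¹) * W := by
        rw [rate_mul, h2]
        norm_num
    _ = _ := by rw [div_eq_mul_inv]; ring

open Classical in
/-- The weighted number of buildings with at least `k` more blocks than `s` whose part in the
layers up to `h` is `s`. -/
noncomputable def extensionSum (k : ℕ) (h : ℤ) (s : Finset Block) : ℝ≥0∞ :=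
  ∑' u : Finset Block, if IsBuilding u ∧ u.filter (·.z ≤ h) = s ∧ s.card + k ≤ u.card
    then rate ^ (u.card - s.card) else 0

section

variable {h : ℤ} {s : Finset Block}

theorem filter_of_filter_addLayer {u : Finset Block} {c d : Cell} (hs : ∀ e ∈ s, e.z ≤ h)
    (hu : u.filter (·.z ≤ h + 1) = addLayer h c d s) : u.filter (·.z ≤ h) = s := by
  rw [← filter_addLayer (c := c) (d := d) hs, ← hu, Finset.filter_filter]
  refine Finset.filter_congr fun e _ => ?_
  constructor
  · intro he; exact ⟨by omega, he⟩
  · exact fun he => he.2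

open Classical in
-- The truncation of `u` at height `h + 1` determines its next layer. Hence at most one single block
-- matches, or one unordered pair, which occurs as two ordered pairs of weight `1 / 2`.
theorem layer_indicator_le (hs : ∀ e ∈ s, e.z ≤ h) (u : Finset Block) :
    (∑' t, if u.filter (·.z ≤ h + 1) = addLayer h t t s then 1 else 0 : ℝ≥0∞) +
      2⁻¹ * ∑' c, ∑' d, (if c ≠ d ∧ u.filter (·.z ≤ h + 1) = addLayer h c d s then 1 else 0) ≤
    if u.filter (·.z ≤ h) = s then 1 else 0 := by
  by_cases h1 : ∃ t, u.filter (·.z ≤ h + 1) = addLayer h t t s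
  · obtain ⟨t₀, ht₀⟩ := h1
    rw [if_pos (filter_of_filter_addLayer hs ht₀), tsum_eq_single t₀, if_pos ht₀]
    · rw [ENNReal.tsum_eq_zero.2, mul_zero, add_zero]
      intro c
      rw [ENNReal.tsum_eq_zero]
      intro d
      rw [if_neg]
      rintro ⟨hcd, he⟩
      rcases addLayer_inj hs (he.symm.trans ht₀) with ⟨h1, h2⟩ | ⟨h1, h2⟩ <;>
        exact hcd (h1.trans h2.symm)
    · intro t ht
      rw [if_neg]
      intro he
      rcases addLayer_inj hs (he.symm.trans ht₀) with ⟨h1, h2⟩ | ⟨h1, h2⟩ <;> exact ht h1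
  · push Not at h1
    rw [ENNReal.tsum_eq_zero.2 fun t => if_neg (h1 t), zero_add]
    by_cases h2 : ∃ c d, u.filter (·.z ≤ h + 1) = addLayer h c d s
    · obtain ⟨c₀, d₀, h₀⟩ := h2
      rw [if_pos (filter_of_filter_addLayer hs h₀)]
      have hsum : ∀ x y : Cell, ∑' c, ∑' d, (if c = x ∧ d = y then 1 else 0 : ℝ≥0∞) = 1 := by
        intro x y
        rw [tsum_eq_single x, tsum_eq_single y]
        · simp
        · intro d hd; simp [hd]
        · intro c hc; simp [hc]
      calc _ ≤ 2⁻¹ * ∑' c, ∑' d, ((if c = c₀ ∧ d = d₀ then 1 else 0 : ℝ≥0∞) +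
            (if c = d₀ ∧ d = c₀ then 1 else 0)) := by
            refine mul_le_mul_right (ENNReal.tsum_le_tsum fun c => ENNReal.tsum_le_tsum fun d => ?_) _
            by_cases h3 : c ≠ d ∧ u.filter (·.z ≤ h + 1) = addLayer h c d s
            · rw [if_pos h3]
              rcases addLayer_inj hs (h3.2.symm.trans h₀) with h | h
              · rw [if_pos h]; exact le_self_add
              · rw [if_pos h]; exact le_add_self
            · rw [if_neg h3]; exact zero_le
        _ = 2⁻¹ * (1 + 1) := by simp only [ENNReal.tsum_add, hsum]
        _ = 1 := by rw [one_add_one_eq_two]; exact ENNReal.inv_mul_cancel (by norm_num) (by norm_num)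
        _ ≤ 1 := le_rfl
    · push Not at h2
      have : ∑' c, ∑' d, (if c ≠ d ∧ u.filter (·.z ≤ h + 1) = addLayer h c d s then 1 else 0 :
          ℝ≥0∞) = 0 :=
        ENNReal.tsum_eq_zero.2 fun c => ENNReal.tsum_eq_zero.2 fun d => if_neg fun h => h2 c d h.2
      rw [this, mul_zero]
      exact zero_le

open Classical in
-- Classifies extensions by their next layer and keeps only layers adding one or two blocks. Each
-- adds at least one block, so `k` further blocks make at least `k + 1`.
theorem extensionSum_succ (k : ℕ) (hs : ∀ e ∈ s, e.z ≤ h) :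
    rate * ∑' t, extensionSum k (h + 1) (addLayer h t t s) +
      rate ^ 2 / 2 * ∑' c, ∑' d, (if c ≠ d then extensionSum k (h + 1) (addLayer h c d s) else 0) ≤
    extensionSum (k + 1) h s := by
  set F : Finset Block → ℝ≥0∞ := fun u =>
    if IsBuilding u ∧ s.card + (k + 1) ≤ u.card then rate ^ (u.card - s.card) else 0 with hF
  have single : ∀ t, rate * extensionSum k (h + 1) (addLayer h t t s) ≤
      ∑' u, F u * (if u.filter (·.z ≤ h + 1) = addLayer h t t s then 1 else 0) := by
    intro t
    rw [extensionSum, ← ENNReal.tsum_mul_left, card_addLayer_self hs]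
    refine ENNReal.tsum_le_tsum fun u => ?_
    by_cases hu : IsBuilding u ∧ u.filter (·.z ≤ h + 1) = addLayer h t t s ∧
        s.card + 1 + k ≤ u.card
    · rw [if_pos hu, if_pos hu.2.1, mul_one, hF, ← pow_succ']
      dsimp only
      rw [if_pos ⟨hu.1, by omega⟩]
      have := hu.2.2
      exact le_of_eq (congrArg _ (by omega))
    · rw [if_neg hu, mul_zero]; exact zero_le
  have pair : ∀ c d, rate ^ 2 * (if c ≠ d then extensionSum k (h + 1) (addLayer h c d s) else 0) ≤
      ∑' u, F u * (if c ≠ d ∧ u.filter (·.z ≤ h + 1) = addLayer h c d s then 1 else 0) := by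
    intro c d
    by_cases hcd : c = d
    · simp [hcd]
    rw [if_pos hcd, extensionSum, ← ENNReal.tsum_mul_left, card_addLayer hs hcd]
    refine ENNReal.tsum_le_tsum fun u => ?_
    by_cases hu : IsBuilding u ∧ u.filter (·.z ≤ h + 1) = addLayer h c d s ∧
        s.card + 2 + k ≤ u.card
    · rw [if_pos hu, if_pos ⟨hcd, hu.2.1⟩, mul_one, hF, ← pow_add]
      dsimp only
      rw [if_pos ⟨hu.1, by omega⟩]
      have := hu.2.2
      exact le_of_eq (congrArg _ (by omega))
    · rw [if_neg hu, mul_zero]; exact zero_le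
  calc _ ≤ (∑' t, ∑' u, F u * (if u.filter (·.z ≤ h + 1) = addLayer h t t s then 1 else 0)) +
        2⁻¹ * ∑' c, ∑' d, ∑' u,
          F u * (if c ≠ d ∧ u.filter (·.z ≤ h + 1) = addLayer h c d s then 1 else 0) := by
        refine add_le_add ?_ ?_
        · rw [← ENNReal.tsum_mul_left]
          exact ENNReal.tsum_le_tsum single
        · rw [div_eq_mul_inv, mul_comm _ 2⁻¹, mul_assoc]
          refine mul_le_mul_right ?_ _
          simp only [← ENNReal.tsum_mul_left]
          exact ENNReal.tsum_le_tsum fun c => ENNReal.tsum_le_tsum fun d => pair c d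
    _ = ∑' u, F u * ((∑' t, if u.filter (·.z ≤ h + 1) = addLayer h t t s then 1 else 0) +
        2⁻¹ * ∑' c, ∑' d,
          (if c ≠ d ∧ u.filter (·.z ≤ h + 1) = addLayer h c d s then 1 else 0)) := by
        have e1 : ∀ c, ∑' d, ∑' u,
            F u * (if c ≠ d ∧ u.filter (·.z ≤ h + 1) = addLayer h c d s then 1 else 0) =
            ∑' u, ∑' d,
            F u * (if c ≠ d ∧ u.filter (·.z ≤ h + 1) = addLayer h c d s then 1 else 0) :=
          fun c => ENNReal.tsum_comm
        simp only [e1]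
        rw [ENNReal.tsum_comm, ENNReal.tsum_comm (α := Cell) (β := Finset Block),
          ← ENNReal.tsum_mul_left, ← ENNReal.tsum_add]
        refine tsum_congr fun u => ?_
        simp only [ENNReal.tsum_mul_left]
        ring
    _ ≤ ∑' u, F u * (if u.filter (·.z ≤ h) = s then 1 else 0) :=
        ENNReal.tsum_le_tsum fun u => mul_le_mul_right (layer_indicator_le hs u) _
    _ = _ := by
        rw [extensionSum]
        refine tsum_congr fun u => ?_
        rw [hF]
        dsimp only
        by_cases h1 : IsBuilding u <;> by_cases h2 : u.filter (·.z ≤ h) = s <;>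
          by_cases h3 : s.card + (k + 1) ≤ u.card <;> simp [h1, h2, h3]

/-- Constant relating potentials to the weight of a completion. -/
noncomputable def completionWeight : ℝ≥0∞ := rate ^ 29 / 4096

theorem completionWeight_pos : 0 < completionWeight :=
  ENNReal.div_pos (ENNReal.pow_pos rate_pos _).ne' (by norm_num)

/-- One completion suffices. At distance at most 14 it needs at most `2 * 14 + 1 = 29` blocks, and
dividing by 4096 absorbs the size of the table entries. -/
theorem le_extensionSum_zero {a b : Cell} (hs : IsSplit h a b s) {V : ℕ} (hV : V < 4096)
    (hab : (a.1 - b.1).natAbs + (a.2.1 - b.2.1).natAbs ≤ 14) :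
    completionWeight * V ≤ extensionSum 0 h s := by
  classical
  obtain ⟨u, hu, huf, hcard⟩ := hs.exists_completion 14 hab
  have h1 : completionWeight * V ≤ rate ^ 29 := by
    rw [completionWeight, ENNReal.div_eq_inv_mul, mul_comm _ (V : ℝ≥0∞), ← mul_assoc]
    refine (mul_le_mul_left (?_ : (V : ℝ≥0∞) * 4096⁻¹ ≤ 1) _).trans (one_mul _).le
    rw [← div_eq_mul_inv]
    exact ENNReal.div_le_of_le_mul (by rw [one_mul]; exact_mod_cast hV.le)
  have h2 : s.card ≤ u.card := by
    rw [← huf]; exact Finset.card_filter_le _ _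
  refine h1.trans (le_trans ?_ (ENNReal.le_tsum u))
  rw [if_pos ⟨hu, huf, by omega⟩]
  exact pow_le_pow_right_of_le_one' rate_le_one (by omega)

end

theorem Table.dist_le_of_pot_ne_zero {T : Table} {a b : Cell} (hT : T.pot a b ≠ 0) :
    (a.1 - b.1).natAbs + (a.2.1 - b.2.1).natAbs ≤ 14 := by
  by_contra hcon
  exact hT (T.off_eq_zero _ _ (by omega))

/-- Induction on `k`, simultaneously for all states: the numerical inequality bounds the potential
by those of the next layers, and `extensionSum_succ` adds up their extensions. The constant is the
same for every `k`. -/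
theorem potential_le_extensionSum (k : ℕ) : ∀ (h : ℤ) (a b : Cell) (s : Finset Block),
    (IsJoined h a b s → completionWeight * joinedTable.pot a b ≤ extensionSum k h s) ∧
    (IsSplit h a b s → completionWeight * splitTable.pot a b ≤ extensionSum k h s) ∧
    (IsSplit h a a s → completionWeight * (1000 : ℕ) ≤ extensionSum k h s) := by
  induction k with
  | zero =>
    intro h a b s
    refine ⟨fun hs => ?_, fun hs => ?_, fun hs => ?_⟩
    · by_cases h0 : joinedTable.pot a b = 0
      · simp [h0]
      · exact le_extensionSum_zero hs.isSplit (joinedTable_small.off_lt _ _ _ _)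
          (Table.dist_le_of_pot_ne_zero h0)
    · by_cases h0 : splitTable.pot a b = 0
      · simp [h0]
      · exact le_extensionSum_zero hs (splitTable_small.off_lt _ _ _ _)
          (Table.dist_le_of_pot_ne_zero h0)
    · exact le_extensionSum_zero hs (by norm_num) (by simp)
  | succ k ih =>
    intro h a b s
    have hpair : ∀ {c d : Cell} {w : ℕ}, (Touch c d → w = 0) →
        (¬ Touch c d → completionWeight * w ≤ extensionSum k (h + 1) (addLayer h c d s)) →
        completionWeight * w ≤
          if c ≠ d then extensionSum k (h + 1) (addLayer h c d s) else 0 := by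
      intro c d w h1 h2
      by_cases hcd : Touch c d
      · simp [h1 hcd]
      · rw [if_pos]
        · exact h2 hcd
        · rintro rfl; exact hcd (touch_self c)
    have hjoined : ∀ a b : Cell, IsJoined h a b s →
        completionWeight * (rate * (1000 * joinedCount a b) + rate ^ 2 / 2 * joinedSum a b) ≤
          extensionSum (k + 1) h s := by
      intro a b hs
      refine le_trans ?_ (extensionSum_succ k hs.1.le)
      rw [mul_add, mul_left_comm, mul_left_comm _ (rate ^ 2 / 2)]
      refine add_le_add (mul_le_mul_right ?_ _) (mul_le_mul_right ?_ _)
      · rw [joinedCount, ← ENNReal.tsum_mul_left, ← ENNReal.tsum_mul_left]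
        refine ENNReal.tsum_le_tsum fun t => ?_
        split_ifs with ht
        · rw [mul_one]
          exact (ih (h + 1) t t _).2.2 (hs.addLayer_split (Or.inl rfl) (Or.inl ht))
        · simp
      · rw [joinedSum, ← ENNReal.tsum_mul_left]
        refine ENNReal.tsum_le_tsum fun c => ?_
        rw [← ENNReal.tsum_mul_left]
        refine ENNReal.tsum_le_tsum fun d => hpair (fun hcd => ?_) fun hcd => ?_
        · simp [joinedWeight, pot_eq_zero_of_touch hcd]
        · rw [joinedWeight]
          split_ifs with h1 h2
          · exact (ih (h + 1) c d _).1 (hs.addLayer_joined (Or.inr hcd) h1.1 h1.2)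
          · exact (ih (h + 1) c d _).2.1 (hs.addLayer_split (Or.inr hcd) h2)
          · simp
    have hsplit : ∀ a b : Cell, IsSplit h a b s →
        completionWeight * (rate * (1000 * splitCount a b) + rate ^ 2 / 2 * splitSum a b) ≤
          extensionSum (k + 1) h s := by
      intro a b hs
      refine le_trans ?_ (extensionSum_succ k hs.1.le)
      rw [mul_add, mul_left_comm, mul_left_comm _ (rate ^ 2 / 2)]
      refine add_le_add (mul_le_mul_right ?_ _) (mul_le_mul_right ?_ _)
      · rw [splitCount, ← ENNReal.tsum_mul_left, ← ENNReal.tsum_mul_left]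
        refine ENNReal.tsum_le_tsum fun t => ?_
        split_ifs with ht
        · rw [mul_one]
          exact (ih (h + 1) t t _).2.2
            (hs.addLayer_split (Or.inl rfl) (Or.inl ht.1) (Or.inl ht.2))
        · simp
      · rw [splitSum, ← ENNReal.tsum_mul_left]
        refine ENNReal.tsum_le_tsum fun c => ?_
        rw [← ENNReal.tsum_mul_left]
        refine ENNReal.tsum_le_tsum fun d => hpair (fun hcd => ?_) fun hcd => ?_
        · simp [splitWeight, pot_eq_zero_of_touch hcd]
        · rw [splitWeight]
          split_ifs with h1 h2
          · rcases h2.1 with h3 | h3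
            · exact (ih (h + 1) c d _).1
                (hs.addLayer_joined (Or.inr hcd) h3.1 h3.2 h2.2.2)
            -- Here `d` is the bridging block, so the roles of `c` and `d` are exchanged.
            · rw [joinedTable.pot_comm, addLayer_comm]
              exact (ih (h + 1) d c _).1
                (hs.addLayer_joined (Or.inr fun e => hcd e.symm) h3.1 h3.2 h2.2.1)
          · exact (ih (h + 1) c d _).2.1 (hs.addLayer_split (Or.inr hcd) h1.1 h1.2)
          · simp
    refine ⟨fun hs => ?_, fun hs => ?_, fun hs => ?_⟩
    · exact (mul_le_mul_right (le_of_scaled (joined_inequality a b)) _).trans (hjoined a b hs)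
    · exact (mul_le_mul_right (le_of_scaled (split_inequality a b)) _).trans (hsplit a b hs)
    · exact (mul_le_mul_right (le_of_scaled (single_inequality a)) _).trans
        -- With both top cells equal, the two alternatives for a split partial building coincide and
        -- it is connected.
        (hjoined a a ⟨hs.1, fun c hc => (hs.2 c hc).elim id id⟩)

/-! ### Closed walks through connected sets -/

section Walks

variable {V : Type*} [DecidableEq V] {G : SimpleGraph V}

theorem exists_adj_of_ssubset {s t : Finset V} (hs : (G.induce (s : Set V)).Connected)
    (hts : t ⊂ s) (ht : t.Nonempty) : ∃ x ∈ t, ∃ y ∈ s \ t, G.Adj x y := by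
  obtain ⟨v, hv⟩ := ht
  obtain ⟨w, hw, hwt⟩ := Finset.exists_of_ssubset hts
  obtain ⟨p⟩ := hs.preconnected ⟨v, hts.1 hv⟩ ⟨w, hw⟩
  obtain ⟨d, -, h1, h2⟩ := p.exists_boundary_dart {x | (x : V) ∈ t} hv hwt
  exact ⟨d.fst, h1, d.snd, Finset.mem_sdiff.2 ⟨d.snd.2, h2⟩, d.adj⟩

/-- As long as the walk misses part of `s`, connectedness gives an edge from a visited `x` to a new
`y`. The detour from `x` to `y` and back adds one vertex and two steps. -/
theorem exists_closed_walk {s : Finset V} (hs : (G.induce (s : Set V)).Connected) {v : V}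
    (hv : v ∈ s) (k : ℕ) (hk : k < s.card) :
    ∃ p : G.Walk v v, p.length = 2 * k ∧ p.support.toFinset ⊆ s ∧
      p.support.toFinset.card = k + 1 := by
  induction k with
  | zero => exact ⟨.nil, rfl, by simpa using hv, by simp⟩
  | succ k ih =>
    obtain ⟨p, hlen, hsub, hcard⟩ := ih (by omega)
    have hss : p.support.toFinset ⊂ s :=
      Finset.ssubset_iff_subset_ne.2 ⟨hsub, fun e => by rw [e] at hcard; omega⟩
    obtain ⟨x, hx, y, hy, hxy⟩ := exists_adj_of_ssubset hs hss ⟨v, by simp⟩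
    rw [List.mem_toFinset] at hx
    rw [Finset.mem_sdiff] at hy
    refine ⟨(p.takeUntil x hx).append (.cons hxy (.cons hxy.symm (p.dropUntil x hx))), ?_, ?_⟩
    · have := congrArg SimpleGraph.Walk.length (p.take_spec hx)
      simp only [SimpleGraph.Walk.length_append, SimpleGraph.Walk.length_cons] at this ⊢
      omega
    · have hsupp : ((p.takeUntil x hx).append
          (.cons hxy (.cons hxy.symm (p.dropUntil x hx)))).support.toFinset =
          insert y p.support.toFinset := by
        ext z
        have h1 : z ∈ p.support ↔ z ∈ (p.takeUntil x hx).support ∨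
            z ∈ (p.dropUntil x hx).support := by
          rw [← SimpleGraph.Walk.mem_support_append_iff, p.take_spec hx]
        have h2 : x ∈ (p.dropUntil x hx).support := SimpleGraph.Walk.start_mem_support _
        rw [List.mem_toFinset, SimpleGraph.Walk.mem_support_append_iff, Finset.mem_insert,
          List.mem_toFinset, h1, SimpleGraph.Walk.support_cons, SimpleGraph.Walk.support_cons,
          List.mem_cons, List.mem_cons]
        constructor
        · rintro (h | rfl | h | h)
          · exact Or.inr (Or.inl h)
          · exact Or.inr (Or.inr h2)
          · exact Or.inl h
          · exact Or.inr (Or.inr h)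
        · rintro (h | h | h)
          · exact Or.inr (Or.inr (Or.inl h))
          · exact Or.inl h
          · exact Or.inr (Or.inr (Or.inr h))
      rw [hsupp, Finset.card_insert_of_notMem hy.2, hcard]
      exact ⟨Finset.insert_subset hy.1 hsub, rfl⟩

theorem exists_supports {nb : V → Finset V} {D : ℕ} (hnb : ∀ v w, G.Adj v w → w ∈ nb v)
    (hD : ∀ v, (nb v).card ≤ D) (m : ℕ) (v : V) :
    ∃ F : Finset (Finset V), F.card ≤ D ^ m ∧
      ∀ (w : V) (p : G.Walk v w), p.length = m → p.support.toFinset ∈ F := by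
  induction m generalizing v with
  | zero =>
    refine ⟨{{v}}, by simp, fun w p hp => ?_⟩
    cases p with
    | nil => simp
    | cons h p => simp at hp
  | succ m ih =>
    choose F hF hF' using ih
    refine ⟨(nb v).biUnion fun w => (F w).image (insert v), ?_, fun w p hp => ?_⟩
    · calc _ ≤ ∑ w ∈ nb v, ((F w).image (insert v)).card := Finset.card_biUnion_le
        _ ≤ ∑ w ∈ nb v, D ^ m :=
            Finset.sum_le_sum fun w _ => Finset.card_image_le.trans (hF w)
        _ = (nb v).card * D ^ m := by simp
        _ ≤ D * D ^ m := Nat.mul_le_mul_right _ (hD v)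
        _ = D ^ (m + 1) := (pow_succ' _ _).symm
    · cases p with
      | nil => simp at hp
      | cons h p =>
        rw [Finset.mem_biUnion]
        refine ⟨_, hnb _ _ h, Finset.mem_image.2 ⟨p.support.toFinset, hF' _ _ p ?_, ?_⟩⟩
        · simpa using hp
        · simp

end Walks

/-- A finite set containing all blocks attached to a given block. -/
noncomputable def neighbours (c : Block) : Finset Block :=
  (Finset.Icc (-4 : ℤ) 4 ×ˢ Finset.Icc (-4 : ℤ) 4 ×ˢ Finset.Icc (-1 : ℤ) 1 ×ˢ
    (Finset.univ : Finset Bool)).image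
    fun o => ⟨c.x + o.1, c.y + o.2.1, c.z + o.2.2.1, o.2.2.2⟩

theorem card_neighbours_le (c : Block) : (neighbours c).card ≤ 486 :=
  Finset.card_image_le.trans (by simp)

theorem mem_neighbours {c d : Block} (h : attachGraph.Adj c d) : d ∈ neighbours c := by
  have hl : ∀ e : Block, e.lenX ≤ 4 ∧ e.lenY ≤ 4 := by
    rintro ⟨x, y, z, _ | _⟩ <;> simp [Block.lenX, Block.lenY]
  have h1 := hl c
  have h2 := hl d
  refine Finset.mem_image.2 ⟨(d.x - c.x, d.y - c.y, d.z - c.z, d.rot), ?_, ?_⟩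
  · simp only [Finset.mem_product, Finset.mem_Icc, Finset.mem_univ, and_true]
    rcases h with ⟨hz, h⟩ | ⟨hz, h⟩ <;> obtain ⟨a1, a2, a3, a4⟩ := h <;> omega
  · ext <;> simp

/-! ### Buildings in normal position -/

/-- Lexicographic position of a block. -/
def key (c : Block) : ℤ ×ₗ ℤ ×ₗ ℤ := toLex (c.z, toLex (c.x, c.y))

/-- The buildings with `n` blocks whose lexicographically least position is the origin. -/
def normalBuildings (n : ℕ) : Set (Finset Block) :=
  {s | s.card = n ∧ IsBuilding s ∧ IsLeast (key '' s) 0}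

/-- Number of buildings up to translation. -/
noncomputable def fixedCount (n : ℕ) : ℕ := (normalBuildings n).ncard

/-- A building of `n + 1` blocks is the support of a closed walk of length `2 * n` from its block at
the origin. That block has two possible orientations, and each step has at most `486 = 9 * 9 * 3 *
2` choices. -/
theorem exists_normalBuildings_subset (n : ℕ) :
    ∃ F : Finset (Finset Block), F.card ≤ 2 * 486 ^ (2 * n) ∧ normalBuildings (n + 1) ⊆ F := by
  obtain ⟨F₁, h₁, h₁'⟩ := exists_supports (G := attachGraph) (fun _ _ => mem_neighbours)
    card_neighbours_le (2 * n) ⟨0, 0, 0, false⟩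
  obtain ⟨F₂, h₂, h₂'⟩ := exists_supports (G := attachGraph) (fun _ _ => mem_neighbours)
    card_neighbours_le (2 * n) ⟨0, 0, 0, true⟩
  refine ⟨F₁ ∪ F₂, (Finset.card_union_le _ _).trans (by omega), ?_⟩
  rintro s ⟨hcard, hs, ⟨c, hc, hc0⟩, -⟩
  obtain ⟨x, y, z, r⟩ := c
  have hz : z = 0 ∧ x = 0 ∧ y = 0 := by
    have h := congrArg ofLex hc0
    have h1 := congrArg Prod.fst h
    have h2 := congrArg (fun p => ofLex p.2) h
    exact ⟨h1, congrArg Prod.fst h2, congrArg Prod.snd h2⟩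
  obtain ⟨rfl, rfl, rfl⟩ := hz
  obtain ⟨p, hp, hsub, hpc⟩ := exists_closed_walk hs.2 hc n (by omega)
  have he : p.support.toFinset = s := Finset.eq_of_subset_of_card_le hsub (by omega)
  rw [Finset.coe_union]
  cases r
  · exact Or.inl (he ▸ h₁' _ p hp)
  · exact Or.inr (he ▸ h₂' _ p hp)

theorem normalBuildings_zero : normalBuildings 0 = ∅ := by
  ext s
  simp only [Set.mem_empty_iff_false, iff_false]
  rintro ⟨h, hs, -⟩
  exact hs.nonempty.ne_empty (Finset.card_eq_zero.1 h)

theorem finite_normalBuildings (n : ℕ) : (normalBuildings n).Finite := by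
  cases n with
  | zero => rw [normalBuildings_zero]; exact Set.finite_empty
  | succ n =>
    obtain ⟨F, -, h⟩ := exists_normalBuildings_subset n
    exact F.finite_toSet.subset h

theorem fixedCount_le (n : ℕ) : fixedCount (n + 1) ≤ 2 * 486 ^ (2 * n) := by
  obtain ⟨F, hF, h⟩ := exists_normalBuildings_subset n
  refine le_trans ?_ hF
  rw [← Set.ncard_coe_finset]
  exact Set.ncard_le_ncard h F.finite_toSet

/-! ### Translation invariance and normalization. -/

theorem overlap_shift {p q r : ℤ} {c d : Block} :
    (c.shift p q r).Overlap (d.shift p q r) ↔ c.Overlap d := by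
  obtain ⟨x, y, z, _ | _⟩ := c <;> obtain ⟨x', y', z', _ | _⟩ := d <;>
    simp only [Block.Overlap, Block.shift, Block.lenX, Block.lenY, if_true, if_false,
      Bool.false_eq_true] <;>
    omega

theorem adj_shift {p q r : ℤ} {c d : Block} (h : attachGraph.Adj c d) :
    attachGraph.Adj (c.shift p q r) (d.shift p q r) := by
  rcases h with ⟨hz, h⟩ | ⟨hz, h⟩
  · exact Or.inl ⟨by simp only [Block.shift]; omega, overlap_shift.2 h⟩
  · exact Or.inr ⟨by simp only [Block.shift]; omega, overlap_shift.2 h⟩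

theorem shift_injective (p q r : ℤ) : Function.Injective (Block.shift p q r) := by
  rintro ⟨x, y, z, t⟩ ⟨x', y', z', t'⟩ h
  simp only [Block.shift, Block.mk.injEq, add_left_inj] at h ⊢
  exact h

theorem collide_shift {p q r : ℤ} {c d : Block} :
    (c.shift p q r).Collide (d.shift p q r) ↔ c.Collide d :=
  and_congr (add_left_inj r) overlap_shift

theorem IsBuilding.shift {s : Finset Block} (hs : IsBuilding s) (p q r : ℤ) :
    IsBuilding (s.image (Block.shift p q r)) := by
  constructor
  · intro c hc d hd hcd
    obtain ⟨c, hc', rfl⟩ := Finset.mem_image.1 hc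
    obtain ⟨d, hd', rfl⟩ := Finset.mem_image.1 hd
    rw [collide_shift]
    exact hs.1 c hc' d hd' fun e => hcd (by rw [e])
  · obtain ⟨a, ha⟩ := hs.nonempty
    refine connected_of_link (Finset.mem_image_of_mem _ ha) fun c hc => ?_
    obtain ⟨c, hc', rfl⟩ := Finset.mem_image.1 hc
    exact (hs.link hc' ha).image fun _ _ => adj_shift

theorem key_image_shift (p q r : ℤ) (s : Finset Block) :
    key '' (s.image (Block.shift p q r) : Finset Block) =
      (· + toLex (r, toLex (p, q))) '' (key '' s) := by
  rw [Finset.coe_image, Set.image_image, Set.image_image]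
  rfl

theorem isLeast_image_add {α : Type*} [AddCommGroup α] [PartialOrder α] [IsOrderedAddMonoid α]
    {S : Set α} {a : α} (h : IsLeast S a) (b : α) : IsLeast ((· + b) '' S) (a + b) := by
  refine ⟨⟨a, h.1, rfl⟩, ?_⟩
  rintro _ ⟨x, hx, rfl⟩
  exact add_le_add_left (h.2 hx) b

theorem IsBuilding.exists_shift_normal {s : Finset Block} (hs : IsBuilding s) :
    ∃ p q r, s.image (Block.shift p q r) ∈ normalBuildings s.card := by
  obtain ⟨c, hc, hmin⟩ := s.exists_min_image key hs.nonempty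
  have hl : IsLeast (key '' s) (key c) := by
    refine ⟨⟨c, hc, rfl⟩, ?_⟩
    rintro _ ⟨d, hd, rfl⟩
    exact hmin d hd
  refine ⟨-c.x, -c.y, -c.z, Finset.card_image_of_injective _ (shift_injective _ _ _),
    hs.shift _ _ _, ?_⟩
  rw [key_image_shift]
  have h0 : key c + toLex (-c.z, toLex (-c.x, -c.y)) = 0 := by
    change toLex (c.z + -c.z, toLex (c.x + -c.x, c.y + -c.y)) = 0
    simp only [add_neg_cancel]
    rfl
  have := isLeast_image_add hl (toLex (-c.z, toLex (-c.x, -c.y)))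
  rwa [h0] at this

/-- A translation moves the least key by its own vector; if both least keys are `0`, the vector
vanishes. -/
theorem eq_of_normal_shift {s t : Finset Block} {p q r : ℤ} (hs : IsLeast (key '' s) 0)
    (ht : IsLeast (key '' t) 0) (h : t = s.image (Block.shift p q r)) : t = s := by
  have h1 := isLeast_image_add hs (toLex (r, toLex (p, q)))
  rw [← key_image_shift, ← h] at h1
  have h2 : toLex (r, toLex (p, q)) = (0 : ℤ ×ₗ ℤ ×ₗ ℤ) := by
    have := h1.unique ht
    rwa [zero_add] at this
  have h3 := congrArg ofLex h2
  have hr : r = 0 := congrArg Prod.fst h3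
  have h4 := congrArg (fun p => ofLex p.2) h3
  have hp : p = 0 := congrArg Prod.fst h4
  have hq : q = 0 := congrArg Prod.snd h4
  subst hr hp hq
  rw [h]
  have : Block.shift 0 0 0 = id := by
    funext c; simp [Block.shift]
  rw [this, Finset.image_id]

/-! ### Comparison of the two counts -/

/-- A building in normal position as a building. -/
def normalToBuilding (n : ℕ) (s : normalBuildings n) : Building n := ⟨s.1, s.2.1, s.2.2.1⟩

theorem normalToBuilding_surjective (n : ℕ) : Function.Surjective fun s : normalBuildings n =>
    (Quotient.mk (buildingSetoid n) (normalToBuilding n s)) := by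
  intro q
  induction q using Quotient.inductionOn with
  | h s =>
    obtain ⟨s, hcard, hs⟩ := s
    obtain ⟨p, q, r, h⟩ := hs.exists_shift_normal
    rw [hcard] at h
    refine ⟨⟨_, h⟩, Quotient.sound ?_⟩
    exact Congruent.symm ⟨0, p, q, r, rfl⟩

instance (n : ℕ) : Finite (normalBuildings n) := (finite_normalBuildings n).to_subtype

instance (n : ℕ) : Finite (Quotient (buildingSetoid n)) :=
  Finite.of_surjective _ (normalToBuilding_surjective n)

theorem T_le_fixedCount (n : ℕ) : T n ≤ fixedCount n :=
  Nat.card_le_card_of_surjective _ (normalToBuilding_surjective n)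

/-- A normal building is determined by its congruence class and the rotation exponent modulo 4 from
a chosen representative: the remaining freedom is a translation, which normal position excludes. -/
theorem fixedCount_le_four_mul (n : ℕ) : fixedCount n ≤ 4 * T n := by
  have hc : ∀ s : normalBuildings n, Congruent
      (Quotient.mk (buildingSetoid n) (normalToBuilding n s)).out.1 s.1 := fun s =>
    Quotient.exact (Quotient.out_eq (Quotient.mk (buildingSetoid n) (normalToBuilding n s)))
  choose k p q r hk using hc
  have hinj : Function.Injective fun s : normalBuildings n =>
      ((⟨k s % 4, Nat.mod_lt _ (by norm_num)⟩ : Fin 4),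
        Quotient.mk (buildingSetoid n) (normalToBuilding n s)) := by
    intro s t h
    simp only [Prod.mk.injEq, Fin.mk.injEq] at h
    obtain ⟨h1, h2⟩ := h
    have hturn : ∀ (m : ℕ) (c : Block), Block.turn^[m] c = Block.turn^[m % 4] c := by
      intro m c
      conv_lhs => rw [← Nat.mod_add_div m 4, Function.iterate_add_apply, Block.turn_four_mul]
    have hs := hk s
    have ht := hk t
    rw [← h2] at ht
    apply Subtype.ext
    symm
    refine eq_of_normal_shift (p := p t - p s) (q := q t - q s) (r := r t - r s) s.2.2.2
      t.2.2.2 ?_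
    rw [ht, hs, Finset.image_image]
    refine Finset.image_congr fun c _ => ?_
    simp only [Function.comp]
    rw [hturn (k t), hturn (k s), h1]
    simp only [Block.shift, Block.mk.injEq, and_true]
    omega
  have := Nat.card_le_card_of_injective _ hinj
  rwa [Nat.card_prod, Nat.card_fin] at this

/-! ### Supermultiplicativity -/

/-- Stacking `t` on the block `c` of `s`. -/
def stack (c : Block) (s t : Finset Block) : Finset Block :=
  s ∪ t.image (Block.shift c.x c.y (c.z + 1))

section

variable {m n : ℕ} {s t : Finset Block} {c : Block}

theorem z_nonneg_of_normal (ht : t ∈ normalBuildings n) {d : Block} (hd : d ∈ t) : 0 ≤ d.z := by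
  have h := ht.2.2.2 ⟨d, hd, rfl⟩
  rcases Prod.Lex.le_iff.1 h with h | h
  · exact le_of_lt h
  · exact h.1.le

theorem z_of_mem_image (ht : t ∈ normalBuildings n) {d : Block}
    (hd : d ∈ t.image (Block.shift c.x c.y (c.z + 1))) : c.z < d.z := by
  obtain ⟨e, he, rfl⟩ := Finset.mem_image.1 hd
  have := z_nonneg_of_normal ht he
  simp only [Block.shift]
  omega

theorem filter_stack (hc : ∀ d ∈ s, d.z ≤ c.z) (ht : t ∈ normalBuildings n) :
    (stack c s t).filter (·.z ≤ c.z) = s := by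
  ext d
  rw [Finset.mem_filter, stack, Finset.mem_union]
  constructor
  · rintro ⟨hd | hd, hz⟩
    · exact hd
    · have := z_of_mem_image ht hd; omega
  · exact fun hd => ⟨Or.inl hd, hc d hd⟩

theorem stack_mem (hs : s ∈ normalBuildings m) (ht : t ∈ normalBuildings n) (hcs : c ∈ s)
    (hc : ∀ d ∈ s, d.z ≤ c.z) : stack c s t ∈ normalBuildings (m + n) := by
  have hz : ∀ {d}, d ∈ t.image (Block.shift c.x c.y (c.z + 1)) → c.z < d.z := z_of_mem_image ht
  have htb := ht.2.1.shift c.x c.y (c.z + 1)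
  refine ⟨?_, ⟨?_, ?_⟩, ?_, ?_⟩
  · rw [stack, Finset.card_union_of_disjoint, hs.1,
      Finset.card_image_of_injective _ (shift_injective _ _ _), ht.1]
    rw [Finset.disjoint_left]
    intro d hd hd'
    have := hc d hd
    have := hz hd'
    omega
  · intro d hd e he hde hcol
    have hz1 := hcol.1
    rcases Finset.mem_union.1 hd with hd | hd <;> rcases Finset.mem_union.1 he with he | he
    · exact hs.2.1.1 d hd e he hde hcol
    · have := hc d hd; have := hz he; omega
    · have := hc e he; have := hz hd; omega
    · exact htb.1 d hd e he hde hcol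
  · obtain ⟨e, he, he0⟩ := ht.2.2.1
    have h1 := congrArg ofLex he0
    have h2 := congrArg (fun p => ofLex p.2) h1
    have ez : e.z = 0 := congrArg Prod.fst h1
    have ex : e.x = 0 := congrArg Prod.fst h2
    have ey : e.y = 0 := congrArg Prod.snd h2
    have he' : Block.shift c.x c.y (c.z + 1) e ∈ t.image (Block.shift c.x c.y (c.z + 1)) :=
      Finset.mem_image_of_mem _ he
    -- The block of `t` at the origin lands directly above `c` with the same corner, so they overlap
    -- whatever their orientations.
    have hadj : attachGraph.Adj (Block.shift c.x c.y (c.z + 1) e) c := by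
      have hl : ∀ e : Block, 0 < e.lenX ∧ 0 < e.lenY := by
        rintro ⟨x, y, z, _ | _⟩ <;> simp [Block.lenX, Block.lenY]
      have l1 := hl c
      have l2 := hl (Block.shift c.x c.y (c.z + 1) e)
      have e1 : (Block.shift c.x c.y (c.z + 1) e).x = c.x := by simp [Block.shift, ex]
      have e2 : (Block.shift c.x c.y (c.z + 1) e).y = c.y := by simp [Block.shift, ey]
      refine Or.inl ⟨by simp [Block.shift, ez], ?_⟩
      unfold Block.Overlap
      rw [e1, e2]
      omega
    refine connected_of_link (a := c) (Finset.mem_union_left _ hcs) fun d hd => ?_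
    rcases Finset.mem_union.1 hd with hd | hd
    · exact (hs.2.1.link hd hcs).mono Finset.subset_union_left
    · exact ((htb.link hd he').mono Finset.subset_union_right).trans
        (Link.of_adj (Finset.mem_union_right _ he') (Finset.mem_union_left _ hcs) hadj)
  · obtain ⟨e, he, he0⟩ := hs.2.2.1
    exact ⟨e, Finset.mem_union_left _ he, he0⟩
  · rintro _ ⟨d, hd, rfl⟩
    rcases Finset.mem_union.1 hd with hd | hd
    · exact hs.2.2.2 ⟨d, hd, rfl⟩
    · have h1 := z_nonneg_of_normal hs hcs
      have h2 := hz hd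
      exact (Prod.Lex.lt_iff.2 (Or.inl (show (0 : ℤ) < d.z by omega))).le

end

/-- Stack `t` on a chosen highest block of `s`. The pair can be recovered: cutting at the height of
that block returns `s`, which determines the block and then `t`. -/
theorem fixedCount_mul_le (m n : ℕ) : fixedCount m * fixedCount n ≤ fixedCount (m + n) := by
  have htop : ∀ s : normalBuildings m, ∃ c ∈ s.1, ∀ d ∈ s.1, d.z ≤ c.z := fun s =>
    s.1.exists_max_image (·.z) s.2.2.1.nonempty
  choose top htop htop' using htop
  have hinj : Function.Injective fun st : normalBuildings m × normalBuildings n =>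
      (⟨stack (top st.1) st.1 st.2, stack_mem st.1.2 st.2.2 (htop _) (htop' _)⟩ :
        normalBuildings (m + n)) := by
    rintro ⟨s, t⟩ ⟨s', t'⟩ h
    have h' : stack (top s) s t = stack (top s') s' t' := congrArg Subtype.val h
    have f1 := filter_stack (htop' s) t.2
    have f2 := filter_stack (htop' s') t'.2
    have hss : s = s' := by
      apply Subtype.ext
      -- The cutting heights are not yet known to agree, but the lower cut lies in the higher one
      -- and both have `m` blocks.
      rcases le_total (top s).z (top s').z with hz | hz
      · refine Finset.eq_of_subset_of_card_le ?_ (by rw [s.2.1, s'.2.1])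
        rw [← f1, ← f2, h']
        exact Finset.monotone_filter_right _ fun d _ hd => hd.trans hz
      · refine (Finset.eq_of_subset_of_card_le ?_ (by rw [s.2.1, s'.2.1])).symm
        rw [← f1, ← f2, h']
        exact Finset.monotone_filter_right _ fun d _ hd => hd.trans hz
    subst hss
    have htt : t.1.image (Block.shift (top s).x (top s).y ((top s).z + 1)) =
        t'.1.image (Block.shift (top s).x (top s).y ((top s).z + 1)) := by
      have hd : ∀ u : normalBuildings n, stack (top s) s u \ s.1 =
          u.1.image (Block.shift (top s).x (top s).y ((top s).z + 1)) := by
        intro u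
        rw [stack, Finset.union_sdiff_left, Finset.sdiff_eq_self_iff_disjoint,
          Finset.disjoint_left]
        intro d hd hd'
        have := htop' s d hd'
        have := z_of_mem_image u.2 hd
        omega
      rw [← hd t, ← hd t', h']
    rw [Subtype.ext (Finset.image_injective (shift_injective _ _ _) htt)]
  have := Nat.card_le_card_of_injective _ hinj
  rwa [Nat.card_prod] at this

theorem singleton_mem_normalBuildings : {⟨0, 0, 0, false⟩} ∈ normalBuildings 1 := by
  refine ⟨rfl, ⟨?_, ?_⟩, ?_, ?_⟩
  · intro c hc d hd hcd
    rw [Finset.mem_singleton] at hc hd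
    exact absurd (hc.trans hd.symm) hcd
  · refine connected_of_link (Finset.mem_singleton_self _) fun c hc => ?_
    rw [Finset.mem_singleton.1 hc]
    exact Link.refl (Finset.mem_singleton_self _)
  · exact ⟨_, Finset.mem_coe.2 (Finset.mem_singleton_self _), rfl⟩
  · rintro _ ⟨d, hd, rfl⟩
    rw [Finset.mem_singleton.1 (Finset.mem_coe.1 hd)]
    exact le_rfl

theorem fixedCount_pos (n : ℕ) : 0 < fixedCount (n + 1) := by
  induction n with
  | zero =>
    exact (Set.ncard_pos (finite_normalBuildings _)).2 ⟨_, singleton_mem_normalBuildings⟩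
  | succ n ih =>
    have h1 : 0 < fixedCount 1 :=
      (Set.ncard_pos (finite_normalBuildings _)).2 ⟨_, singleton_mem_normalBuildings⟩
    exact (Nat.mul_pos ih h1).trans_le (fixedCount_mul_le _ _)

theorem fixedCount_zero : fixedCount 0 = 0 := by
  rw [fixedCount, normalBuildings_zero, Set.ncard_empty]

/-! ### Existence of the limit -/

theorem subadditive_neg_log : Subadditive fun n => -Real.log (fixedCount n) := by
  intro m n
  rcases m with _ | m
  -- Since `fixedCount 0 = 0`, this case rests on the convention `Real.log 0 = 0`.
  · simp [fixedCount_zero]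
  rcases n with _ | n
  · simp [fixedCount_zero]
  have h1 : (0 : ℝ) < fixedCount (m + 1) := by exact_mod_cast fixedCount_pos m
  have h2 : (0 : ℝ) < fixedCount (n + 1) := by exact_mod_cast fixedCount_pos n
  have h3 : (fixedCount (m + 1) * fixedCount (n + 1) : ℝ) ≤ fixedCount (m + 1 + (n + 1)) := by
    exact_mod_cast fixedCount_mul_le _ _
  have h4 := Real.log_le_log (mul_pos h1 h2) h3
  rw [Real.log_mul h1.ne' h2.ne'] at h4
  linarith

theorem log_fixedCount_le (n : ℕ) : Real.log (fixedCount n) ≤ n * (2 * Real.log 486) := by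
  have hl : Real.log 2 ≤ 2 * Real.log 486 := by
    have h1 : Real.log 2 ≤ Real.log 486 := Real.log_le_log (by norm_num) (by norm_num)
    have h2 : 0 ≤ Real.log 2 := Real.log_nonneg (by norm_num)
    linarith
  rcases n with _ | n
  · simp [fixedCount_zero]
  have h1 : (0 : ℝ) < fixedCount (n + 1) := by exact_mod_cast fixedCount_pos n
  have h2 : (fixedCount (n + 1) : ℝ) ≤ 2 * 486 ^ (2 * n) := by exact_mod_cast fixedCount_le n
  have h3 := Real.log_le_log h1 h2
  rw [Real.log_mul (by norm_num) (by positivity), Real.log_pow] at h3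
  push_cast at h3 ⊢
  linarith

theorem bddBelow_neg_log : BddBelow (Set.range fun n : ℕ => -Real.log (fixedCount n) / n) := by
  refine ⟨-(2 * Real.log 486), ?_⟩
  rintro _ ⟨n, rfl⟩
  rcases n with _ | n
  · have : 0 ≤ Real.log 486 := Real.log_nonneg (by norm_num)
    simp [fixedCount_zero, this]
  · have h := log_fixedCount_le (n + 1)
    have hn : (0 : ℝ) < ((n + 1 : ℕ) : ℝ) := by positivity
    rw [le_div_iff₀ hn]
    linarith

/-- The exponential growth rate of the number of buildings up to translation, as a logarithm. -/
noncomputable def fixedEntropy : ℝ := -subadditive_neg_log.lim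

theorem tendsto_fixedCount :
    Tendsto (fun n : ℕ => Real.log (fixedCount n) / n) atTop (𝓝 fixedEntropy) := by
  have h := (subadditive_neg_log.tendsto_lim bddBelow_neg_log).neg
  refine h.congr fun n => ?_
  rw [neg_div, neg_neg]

/-- Fekete's limit is the infimum of the quotients of the subadditive sequence, so the bound holds
for every `n`, not only asymptotically. -/
theorem fixedCount_le_exp (n : ℕ) : (fixedCount n : ℝ) ≤ Real.exp fixedEntropy ^ n := by
  rcases n with _ | n
  · simp [fixedCount_zero]
  have h := subadditive_neg_log.lim_le_div bddBelow_neg_log (Nat.succ_ne_zero n)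
  have h1 : (0 : ℝ) < fixedCount (n + 1) := by exact_mod_cast fixedCount_pos n
  have hn : (0 : ℝ) < ((n + 1 : ℕ) : ℝ) := by positivity
  rw [le_div_iff₀ hn] at h
  rw [← Real.exp_nat_mul, ← Real.log_le_iff_le_exp h1, fixedEntropy]
  linarith

theorem tendsto_log_T : Tendsto (fun n : ℕ => Real.log (T n) / n) atTop (𝓝 fixedEntropy) := by
  have h4 : Tendsto (fun n : ℕ => Real.log (fixedCount n) / n - Real.log 4 / n) atTop
      (𝓝 fixedEntropy) := by
    have := tendsto_fixedCount.sub (tendsto_const_div_atTop_nhds_zero_nat (Real.log 4))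
    rwa [sub_zero] at this
  have hpos : ∀ n : ℕ, 1 ≤ n → (0 : ℝ) < fixedCount n := by
    intro n hn
    obtain ⟨k, rfl⟩ := Nat.exists_eq_add_of_le' hn
    exact_mod_cast fixedCount_pos k
  have hT : ∀ n : ℕ, (fixedCount n : ℝ) ≤ 4 * T n := fun n => by
    exact_mod_cast fixedCount_le_four_mul n
  have hT' : ∀ n : ℕ, (T n : ℝ) ≤ fixedCount n := fun n => by
    exact_mod_cast T_le_fixedCount n
  refine tendsto_of_tendsto_of_tendsto_of_le_of_le' h4 tendsto_fixedCount ?_ ?_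
  · filter_upwards [eventually_ge_atTop 1] with n hn
    have h1 := hpos n hn
    have h2 : (0 : ℝ) < T n := by linarith [hT n]
    rw [← sub_div]
    refine div_le_div_of_nonneg_right ?_ (Nat.cast_nonneg n)
    have h3 := Real.log_le_log h1 (hT n)
    rw [Real.log_mul (by norm_num) h2.ne'] at h3
    linarith
  · filter_upwards [eventually_ge_atTop 1] with n hn
    have h1 := hpos n hn
    have h2 : (0 : ℝ) < T n := by linarith [hT n]
    exact div_le_div_of_nonneg_right (Real.log_le_log h2 (hT' n)) (Nat.cast_nonneg n)

/-! ### The lower bound -/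

/-- The buildings over a fixed single bottom block are in normal position. -/
theorem mem_normalBuildings_of_filter {u : Finset Block} (hu : IsBuilding u)
    (h : u.filter (·.z ≤ 0) = {⟨0, 0, 0, false⟩}) : u ∈ normalBuildings u.card := by
  refine ⟨rfl, hu, ?_, ?_⟩
  · have : (⟨0, 0, 0, false⟩ : Block) ∈ u.filter (·.z ≤ 0) := by rw [h]; simp
    exact ⟨_, (Finset.mem_filter.1 this).1, rfl⟩
  · rintro _ ⟨d, hd, rfl⟩
    by_cases hz : d.z ≤ 0
    · have : d ∈ u.filter (·.z ≤ 0) := Finset.mem_filter.2 ⟨hd, hz⟩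
      rw [h, Finset.mem_singleton] at this
      rw [this]
      exact le_rfl
    · exact (Prod.Lex.lt_iff.2 (Or.inl (show (0 : ℤ) < d.z by omega))).le

/-- Every building whose only block at height at most `0` is the one at the origin is already in
normal position, so an extension by `n` blocks is counted in `fixedCount (n + 1)`. -/
theorem extensionSum_singleton_le (k : ℕ) : extensionSum k 0 {⟨0, 0, 0, false⟩} ≤
    ∑' n : ℕ, if k ≤ n then (fixedCount (n + 1) : ℝ≥0∞) * rate ^ n else 0 := by
  classical
  have h1 : ∀ u : Finset Block, (if IsBuilding u ∧ u.filter (·.z ≤ 0) = {⟨0, 0, 0, false⟩} ∧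
      ({⟨0, 0, 0, false⟩} : Finset Block).card + k ≤ u.card
      then rate ^ (u.card - ({⟨0, 0, 0, false⟩} : Finset Block).card) else 0) ≤
      ∑' n : ℕ, if k ≤ n ∧ u ∈ normalBuildings (n + 1) then rate ^ n else 0 := by
    intro u
    split_ifs with hu
    · obtain ⟨hu1, hu2, hu3⟩ := hu
      rw [Finset.card_singleton] at hu3 ⊢
      have hm := mem_normalBuildings_of_filter hu1 hu2
      have hc : u.card - 1 + 1 = u.card := by omega
      refine le_trans (le_of_eq ?_) (ENNReal.le_tsum (u.card - 1))
      rw [if_pos ⟨by omega, by rw [hc]; exact hm⟩]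
    · exact zero_le
  refine (ENNReal.tsum_le_tsum h1).trans ?_
  rw [ENNReal.tsum_comm]
  refine ENNReal.tsum_le_tsum fun n => ?_
  by_cases hk : k ≤ n
  · simp only [hk, true_and, if_true]
    rw [tsum_eq_sum (s := (finite_normalBuildings (n + 1)).toFinset)]
    · rw [Finset.sum_congr rfl fun u hu => if_pos ((Set.Finite.mem_toFinset _).1 hu),
        Finset.sum_const, nsmul_eq_mul, fixedCount,
        Set.ncard_eq_toFinset_card _ (finite_normalBuildings (n + 1))]
    · intro u hu
      exact if_neg fun h => hu ((Set.Finite.mem_toFinset _).2 h)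
  · simp [hk]

theorem tsum_ite_le_eq (k : ℕ) (f : ℕ → ℝ≥0∞) :
    ∑' n, (if k ≤ n then f n else 0) = ∑' n, f (n + k) := by
  have h := Summable.sum_add_tsum_nat_add' (f := fun n => if k ≤ n then f n else 0) (k := k)
    ENNReal.summable
  rw [← h, Finset.sum_eq_zero, zero_add]
  · exact tsum_congr fun n => if_pos (Nat.le_add_left _ _)
  · intro n hn
    exact if_neg (by rw [Finset.mem_range] at hn; omega)

theorem rate_eq_ofReal : rate = ENNReal.ofReal (100 / 7833) := by
  rw [ENNReal.ofReal_div_of_pos (by norm_num), rate]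
  norm_num

theorem le_exp_fixedEntropy : 78.33 ≤ Real.exp fixedEntropy := by
  by_contra! hlt
  set x : ℝ := Real.exp fixedEntropy * (100 / 7833) with hx
  have hx0 : 0 ≤ x := by positivity
  have hx1 : x < 1 := by
    rw [hx]
    linarith
  have hbound : ∀ k : ℕ, completionWeight * (1000 : ℕ) ≤
      ENNReal.ofReal (Real.exp fixedEntropy * (x ^ k * (1 - x)⁻¹)) := by
    intro k
    -- The cell `(1, 2, false)` is the centre of the `2 × 4` block with corner at the origin.
    have hs : IsSplit 0 (1, 2, false) (1, 2, false) {⟨0, 0, 0, false⟩} := by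
      have hb : blockAt 0 (1, 2, false) = ⟨0, 0, 0, false⟩ := by simp [blockAt, half]
      refine ⟨⟨?_, ?_, ?_⟩, ?_⟩
      · exact singleton_mem_normalBuildings.2.1.1
      · intro c hc
        rw [Finset.mem_singleton.1 hc]
      · intro a ha
        simp only [Finset.pair_eq_singleton, Finset.mem_singleton] at ha
        rw [ha, hb]
        simp
      · intro c hc
        rw [Finset.mem_singleton.1 hc, hb]
        exact Or.inl (Link.refl (Finset.mem_singleton_self _))
    refine ((potential_le_extensionSum k 0 _ (1, 2, false) _).2.2 hs).trans
      ((extensionSum_singleton_le k).trans ?_)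
    have hterm : ∀ n : ℕ, (if k ≤ n then (fixedCount (n + 1) : ℝ≥0∞) * rate ^ n else 0) ≤
        if k ≤ n then ENNReal.ofReal (Real.exp fixedEntropy * x ^ n) else 0 := by
      intro n
      split_ifs
      · rw [rate_eq_ofReal, ← ENNReal.ofReal_natCast, ← ENNReal.ofReal_pow (by norm_num),
          ← ENNReal.ofReal_mul (Nat.cast_nonneg _)]
        refine ENNReal.ofReal_le_ofReal ?_
        calc (fixedCount (n + 1) : ℝ) * (100 / 7833) ^ n
            ≤ Real.exp fixedEntropy ^ (n + 1) * (100 / 7833) ^ n :=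
              mul_le_mul_of_nonneg_right (fixedCount_le_exp _) (by positivity)
          _ = _ := by rw [hx, mul_pow]; ring
      · exact le_rfl
    refine (ENNReal.tsum_le_tsum hterm).trans ?_
    have hsum : HasSum (fun n : ℕ => Real.exp fixedEntropy * x ^ (n + k))
        (Real.exp fixedEntropy * (x ^ k * (1 - x)⁻¹)) := by
      have := ((hasSum_geometric_of_lt_one hx0 hx1).mul_left (x ^ k)).mul_left
        (Real.exp fixedEntropy)
      simpa only [pow_add, mul_comm] using this
    rw [← hsum.tsum_eq, ENNReal.ofReal_tsum_of_nonneg (fun n => by positivity) hsum.summable]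
    rw [tsum_ite_le_eq]
  -- The upper bound tends to `0` as `k` grows, while the left side of `hbound` is a positive
  -- constant.
  have hlim : Tendsto (fun k : ℕ => ENNReal.ofReal
      (Real.exp fixedEntropy * (x ^ k * (1 - x)⁻¹))) atTop (𝓝 0) := by
    have h := ((tendsto_pow_atTop_nhds_zero_of_lt_one hx0 hx1).mul_const (1 - x)⁻¹).const_mul
      (Real.exp fixedEntropy)
    rw [zero_mul, mul_zero] at h
    simpa using ENNReal.tendsto_ofReal h
  have h0 := ge_of_tendsto' hlim hbound
  have hp : 0 < completionWeight * (1000 : ℕ) :=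
    ENNReal.mul_pos completionWeight_pos.ne' (by norm_num)
  exact absurd h0 (not_le.2 hp)

end Lego

theorem mainTheorem4 :
    Tendsto (fun n : ℕ => Real.log (Lego.T n : ℝ) / (n : ℝ)) atTop (𝓝 Lego.entropy) ∧
      (78.32 : ℝ) < Lego.growthRate := by
  have h : Lego.entropy = Lego.fixedEntropy := Lego.tendsto_log_T.limUnder_eq
  rw [Lego.growthRate, h]
  -- The contradiction argument gives only `78.33 ≤ h`; strictness comes from `78.32 < 78.33`.
  refine ⟨Lego.tendsto_log_T, lt_of_lt_of_le ?_ Lego.le_exp_fixedEntropy⟩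
  norm_num
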